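/- For $j=1,2$ let $R_j$ be the $j$-th component of the Riesz transform on $\mathbb{R}^2$, the Fourier multiplier with symbol $-i\xi_j/|\xi|$, acting on the tempered distributions whose Fourier transform is a function; let $R_1^2=R_1\circ R_1$. Then $R_1^2$ is a bounded negative operator on $L^2(\mathbb{R}^2)$, that is, $-R_1^2$ is self-adjoint and $\langle R_1^2 f,f\rangle_{L^2}\le 0$ for all $f\in L^2(\mathbb{R}^2)$. Nevertheless, there is a non-trivial, non-negative $\tilde W\in L^1(\mathbb{R}^2)$ such that $R_1^2\tilde W$ is a function which is non-negative almost everywhere on the (closed) support of $\tilde W$. Moreover, $\tilde W$ can be chosen such that $\tilde W\notin L^2(\mathbb{R}^2)$; $\tilde W\in L^p(\mathbb{R}^2)$ for some $1<p<2$; $\tilde W$ vanishes outside the cone $$\mathcal{C}=\Big\{(r\cos\theta,r\sin\theta): r>0,\ \tfrac{3\pi}{8}<|\theta|<\tfrac{5\pi}{8}\Big\};$$ and $\tilde W$ is singular at the origin in the sense that $\tilde W\notin L^2(B_\delta(0))$ for every $\delta>0$. -/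

import Mathlib

open MeasureTheory
open scoped SchwartzMap FourierTransform ENNReal

noncomputable section

namespace RieszSquare

/-- The Euclidean plane. -/
abbrev Plane : Type := EuclideanSpace ℝ (Fin 2)

/-- The tempered distribution `T` is the function `f`: every Schwartz function is integrable
against `f`, and `T` is integration against `f`. -/
def Represents (f : Plane → ℂ) (T : 𝓢'(Plane, ℂ)) : Prop :=
  ∀ φ : 𝓢(Plane, ℂ),
    Integrable (fun x => φ x * f x) volume ∧ T φ = ∫ x, φ x * f x

/-- `S` is the `j`-th component of the Riesz transform of `T`: the Fourier transform of `T` is a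
function `m`, and the Fourier transform of `S` is the function `-i (ξ_j / |ξ|) m(ξ)`. -/
def IsRieszTransform (j : Fin 2) (T S : 𝓢'(Plane, ℂ)) : Prop :=
  ∃ m : Plane → ℂ,
    Represents m (𝓕 T) ∧
    Represents (fun ξ => -Complex.I * ((ξ j / ‖ξ‖ : ℝ) : ℂ) * m ξ) (𝓕 S)

/-- `g = R₁² f` for functions `f` and `g` on the plane, where `R₁²` is the composition of the
first component of the Riesz transform (index `0`) with itself. The intermediate object `R₁ f` is
allowed to be a distribution, since `R₁` does not map `L¹` to `L¹`. -/
def IsRieszOneSq (f g : Plane → ℂ) : Prop :=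
  ∃ T U S : 𝓢'(Plane, ℂ),
    Represents f T ∧ IsRieszTransform 0 T U ∧ IsRieszTransform 0 U S ∧ Represents g S

/-- The open double cone `3π/8 < |θ| < 5π/8` around the vertical axis, in polar coordinates. -/
def verticalCone : Set Plane :=
  {x | ∃ r θ : ℝ, 0 < r ∧ 3 * Real.pi / 8 < |θ| ∧ |θ| < 5 * Real.pi / 8 ∧
    x 0 = r * Real.cos θ ∧ x 1 = r * Real.sin θ}

end RieszSquare

end

noncomputable section

namespace RieszSquare

open scoped LineDeriv

/-! ### Functions as tempered distributions -/

/-! On `L²`, Plancherel turns `R₁²` into multiplication by the square of a bounded, purely imaginary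
symbol, so `-R₁²` is positive (`isPositive_neg_rieszOneSqL2`).

For the counterexample, let `b(z) = max(1 - |z|², 0)` and `Δu = b`. Then `R₁² b = -∂₁² u` is
explicit: it is at least `-1/2` on the unit disc, and outside it equals `(z₀² - z₁²) / (4|z|⁴)`,
which is positive in horizontal directions. Hence bumps placed side by side help each other, and
enough of them can beat the negative self-interaction.

The function is a sum of bumps `c b((x - y)/r)` on disjoint discs. In cluster `n`, the discs shrink
by halves towards the tip `(0, 2⁻ⁿ)`, while their masses `c r²` decay only by the ratio `999/1000`.
Seen from one disc, all smaller discs of its cluster lie in a horizontal direction at a distance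
comparable to its radius, and together they carry 999 times its mass; this dominates the
self-interaction (`cluster_response_ge`). The other clusters act with uncontrolled sign, but their
total is small (`cluster_response_ge_of_ne`), whence `responseSum_nonneg`.

The `L²` masses `c² r²` blow up along each cluster and the clusters accumulate at the origin
(`not_memLp_two_bumpSum_ball`), while the `L^p` norm is finite for `p = 3000/2999`. Responses decay
only like `|z|⁻²` and are not controlled in `L¹`; their `L^p` size `c r^(2/p)` is summable, so `R₁²`
may be applied term by term in weak form (`isRieszOneSq_bumpSum`). The closed support adds only
countably many points to the discs (`ae_mem_disc_of_mem_tsupport`). -/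

theorem Represents.congr_ae {f g : Plane → ℂ} {T : 𝓢'(Plane, ℂ)} (hf : Represents f T)
    (hfg : f =ᵐ[volume] g) : Represents g T := by
  intro φ
  have h : (fun x => φ x * f x) =ᵐ[volume] fun x => φ x * g x := by
    filter_upwards [hfg] with x hx using by rw [hx]
  exact ⟨(hf φ).1.congr h, (hf φ).2.trans (integral_congr_ae h)⟩

theorem represents_toTemperedDistribution {p : ℝ≥0∞} [hp : Fact (1 ≤ p)]
    (f : Lp ℂ p (volume : Measure Plane)) : Represents f (Lp.toTemperedDistribution f) := by
  intro φ
  have := ENNReal.HolderConjugate.inv_one_sub_inv' hp.out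
  refine ⟨?_, by simp⟩
  -- `(1 - p⁻¹)⁻¹` is the exponent conjugate to `p`, so Hölder applies.
  have h1 : MemLp (φ : Plane → ℂ) (1 - p⁻¹)⁻¹ volume := φ.memLp _ _
  exact memLp_one_iff_integrable.1 (MemLp.mul (p := (1 - p⁻¹)⁻¹) (q := p) (Lp.memLp f) h1)

theorem exists_represents_of_memLp {p : ℝ≥0∞} [Fact (1 ≤ p)] {f : Plane → ℂ}
    (hf : MemLp f p volume) : ∃ T : 𝓢'(Plane, ℂ), Represents f T :=
  ⟨_, (represents_toTemperedDistribution hf.toLp).congr_ae hf.coeFn_toLp⟩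

theorem represents_fourier_of_integrable {f : Plane → ℂ} {T : 𝓢'(Plane, ℂ)}
    (hf : Integrable f volume) (hT : Represents f T) : Represents (𝓕 f) (𝓕 T) := by
  intro φ
  have hcont : Continuous (𝓕 f) :=
    VectorFourier.fourierIntegral_continuous Real.continuous_fourierChar
      continuous_inner hf
  constructor
  · refine φ.integrable.mul_bdd (c := ∫ x, ‖f x‖) hcont.aestronglyMeasurable ?_
    exact .of_forall fun ξ => VectorFourier.norm_fourierIntegral_le_integral_norm _ _ _ _ _
  · rw [TemperedDistribution.fourier_apply, (hT _).2]
    simpa using! VectorFourier.integral_bilin_fourierIntegral_eq_flip (.mul ℂ ℂ) (L := innerₗ Plane)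
      Real.continuous_fourierChar continuous_inner φ.integrable hf

/-- The symbol `-i ξ₁ / |ξ|` of the first component of the Riesz transform. -/
def rieszSymbol (ξ : Plane) : ℂ := -Complex.I * ((ξ 0 / ‖ξ‖ : ℝ) : ℂ)

theorem norm_rieszSymbol_le (ξ : Plane) : ‖rieszSymbol ξ‖ ≤ 1 := by
  have h : |ξ 0| ≤ ‖ξ‖ := by simpa using PiLp.norm_apply_le ξ 0
  simp only [rieszSymbol, norm_mul, norm_neg, Complex.norm_I, one_mul, Complex.norm_real,
    Real.norm_eq_abs, abs_div, abs_norm]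
  exact div_le_one_of_le₀ h (norm_nonneg _)

theorem measurable_rieszSymbol : Measurable rieszSymbol := by
  unfold rieszSymbol
  have h : Measurable fun ξ : Plane => ξ 0 := by fun_prop
  fun_prop

theorem memLp_rieszSymbol_mul {p : ℝ≥0∞} {f : Plane → ℂ} (hf : MemLp f p volume) :
    MemLp (fun ξ => rieszSymbol ξ * f ξ) p volume := by
  refine hf.of_le (measurable_rieszSymbol.aestronglyMeasurable.mul hf.1) (.of_forall fun ξ => ?_)
  rw [norm_mul]
  exact mul_le_of_le_one_left (norm_nonneg _) (norm_rieszSymbol_le ξ)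

/-- Composition of the first Riesz transform with itself, when the Fourier transform is in some
`L^p`. -/
theorem isRieszOneSq_of_memLp_fourier {p : ℝ≥0∞} [Fact (1 ≤ p)] {f g m : Plane → ℂ}
    {T S : 𝓢'(Plane, ℂ)} (hf : Represents f T) (hm : Represents m (𝓕 T)) (hmp : MemLp m p volume)
    (hS : Represents (fun ξ => rieszSymbol ξ * (rieszSymbol ξ * m ξ)) (𝓕 S))
    (hg : Represents g S) : IsRieszOneSq f g := by
  -- The intermediate `R₁ f` is `𝓕⁻ V`; it exists as a distribution because the symbol is bounded,
  -- and it need not be a function.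
  obtain ⟨V, hV⟩ := exists_represents_of_memLp (memLp_rieszSymbol_mul hmp)
  have hV' : Represents (fun ξ => rieszSymbol ξ * m ξ) (𝓕 (𝓕⁻ V)) := by
    rwa [FourierTransform.fourier_fourierInv_eq]
  exact ⟨T, 𝓕⁻ V, S, hf, ⟨m, hm, hV'⟩, ⟨_, hV', hS⟩, hg⟩

theorem rieszSymbol_mul_self (ξ : Plane) :
    rieszSymbol ξ * rieszSymbol ξ = -(((ξ 0 / ‖ξ‖) ^ 2 : ℝ) : ℂ) := by
  simp only [rieszSymbol]
  push_cast
  ring_nf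
  simp

theorem memLp_top_fourier {f : Plane → ℂ} (hf : Integrable f volume) :
    MemLp (𝓕 f) ∞ volume := by
  have hcont : Continuous (𝓕 f) :=
    VectorFourier.fourierIntegral_continuous Real.continuous_fourierChar
      continuous_inner hf
  exact memLp_top_of_bound hcont.aestronglyMeasurable (∫ x, ‖f x‖) (.of_forall fun ξ =>
    VectorFourier.norm_fourierIntegral_le_integral_norm _ _ _ _ _)

/-- For integrable `f`, the relation `g = R₁² f` in its weak form. -/
theorem isRieszOneSq_of_integral_eq {f g : Plane → ℂ} (hf : Integrable f volume)
    (hg : ∀ φ : 𝓢(Plane, ℂ), Integrable (fun x => φ x * g x) volume)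
    (h : ∀ ψ : 𝓢(Plane, ℂ), ∫ x, 𝓕 ψ x * g x =
      ∫ ξ, ψ ξ * (rieszSymbol ξ * (rieszSymbol ξ * 𝓕 f ξ))) : IsRieszOneSq f g := by
  obtain ⟨T, hT⟩ := exists_represents_of_memLp (memLp_one_iff_integrable.2 hf)
  have hm := represents_fourier_of_integrable hf hT
  obtain ⟨V, hV⟩ := exists_represents_of_memLp
    (memLp_rieszSymbol_mul (memLp_rieszSymbol_mul (memLp_top_fourier hf)))
  refine isRieszOneSq_of_memLp_fourier (S := 𝓕⁻ V) hT hm (memLp_top_fourier hf)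
    (by rwa [FourierTransform.fourier_fourierInv_eq]) fun φ => ⟨hg φ, ?_⟩
  rw [TemperedDistribution.fourierInv_apply, (hV _).2, ← h]
  simp

/-! ### The operator on `L²` -/

/-- Multiplication by the symbol, as an operator on `L²`. -/
def rieszMulL2 : Lp ℂ 2 (volume : Measure Plane) →L[ℂ] Lp ℂ 2 (volume : Measure Plane) :=
  (ContinuousLinearMap.mul ℂ ℂ).holderL volume ∞ 2 2
    ((memLp_top_of_bound measurable_rieszSymbol.aestronglyMeasurable 1
      (.of_forall norm_rieszSymbol_le)).toLp rieszSymbol)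

theorem coeFn_rieszMulL2 (f : Lp ℂ 2 (volume : Measure Plane)) :
    rieszMulL2 f =ᵐ[volume] fun ξ => rieszSymbol ξ * f ξ := by
  refine ((ContinuousLinearMap.mul ℂ ℂ).coeFn_holder _ f).trans ?_
  filter_upwards [(memLp_top_of_bound measurable_rieszSymbol.aestronglyMeasurable 1
      (.of_forall norm_rieszSymbol_le)).coeFn_toLp] with ξ hξ
  simp [hξ]

/-- The operator `R₁²` on `L²`. -/
def rieszOneSqL2 : Lp ℂ 2 (volume : Measure Plane) →L[ℂ] Lp ℂ 2 (volume : Measure Plane) :=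
  ((Lp.fourierTransformₗᵢ Plane ℂ).symm : _ →L[ℂ] _) ∘L (rieszMulL2 ∘L rieszMulL2) ∘L
    ((Lp.fourierTransformₗᵢ Plane ℂ) : _ →L[ℂ] _)

theorem isRieszOneSq_rieszOneSqL2 (f : Lp ℂ 2 (volume : Measure Plane)) :
    IsRieszOneSq f (rieszOneSqL2 f) := by
  have h1 : Represents (𝓕 f : Lp ℂ 2 (volume : Measure Plane)) (𝓕 (Lp.toTemperedDistribution f)) := by
    rw [Lp.fourier_toTemperedDistribution_eq]
    exact represents_toTemperedDistribution _
  refine isRieszOneSq_of_memLp_fourier (represents_toTemperedDistribution f) h1 (Lp.memLp _) ?_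
    (represents_toTemperedDistribution _)
  rw [Lp.fourier_toTemperedDistribution_eq]
  refine (represents_toTemperedDistribution _).congr_ae ?_
  have h2 : 𝓕 (rieszOneSqL2 f) = rieszMulL2 (rieszMulL2 (𝓕 f)) :=
    FourierTransform.fourier_fourierInv_eq (rieszMulL2 (rieszMulL2 (𝓕 f)))
  rw [h2]
  filter_upwards [coeFn_rieszMulL2 (rieszMulL2 (𝓕 f)), coeFn_rieszMulL2 (𝓕 f)] with ξ h3 h4
  rw [h3, h4]

/-- The symbol is purely imaginary, so the multiplier is skew-adjoint. -/
theorem adjoint_rieszMulL2 (f g : Lp ℂ 2 (volume : Measure Plane)) :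
    inner ℂ (rieszMulL2 f) g = -inner ℂ f (rieszMulL2 g) := by
  rw [L2.inner_def, L2.inner_def, ← integral_neg]
  refine integral_congr_ae ?_
  filter_upwards [coeFn_rieszMulL2 f, coeFn_rieszMulL2 g] with ξ h1 h2
  rw [h1, h2]
  simp [rieszSymbol]
  ring

theorem inner_rieszOneSqL2 (f g : Lp ℂ 2 (volume : Measure Plane)) :
    inner ℂ (rieszOneSqL2 f) g = -inner ℂ (rieszMulL2 (𝓕 f)) (rieszMulL2 (𝓕 g)) := by
  have h2 : 𝓕 (rieszOneSqL2 f) = rieszMulL2 (rieszMulL2 (𝓕 f)) :=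
    FourierTransform.fourier_fourierInv_eq (rieszMulL2 (rieszMulL2 (𝓕 f)))
  rw [← Lp.inner_fourier_eq, h2, adjoint_rieszMulL2]

theorem isPositive_neg_rieszOneSqL2 : (-rieszOneSqL2).IsPositive := by
  rw [ContinuousLinearMap.isPositive_def']
  constructor
  · rw [ContinuousLinearMap.isSelfAdjoint_iff_isSymmetric]
    intro f g
    change inner ℂ (-rieszOneSqL2 f) g = inner ℂ f (-rieszOneSqL2 g)
    rw [inner_neg_left, inner_neg_right, inner_rieszOneSqL2, ← inner_conj_symm f,
      inner_rieszOneSqL2, map_neg, inner_conj_symm]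
  · intro f
    rw [ContinuousLinearMap.reApplyInnerSelf_apply]
    change 0 ≤ RCLike.re (inner ℂ (-rieszOneSqL2 f) f)
    rw [inner_neg_left, inner_rieszOneSqL2, neg_neg]
    exact inner_self_nonneg

/-! ### Identification of `R₁² f` from the differential equation `Δ g = -∂₁² f` -/

theorem hasTemperateGrowth_coord_sq (j : Fin 2) :
    (fun ξ : Plane => ((-(4 * Real.pi ^ 2 * ξ j ^ 2) : ℝ) : ℂ)).HasTemperateGrowth := by
  have h1 : (fun x : Plane => inner ℝ x (EuclideanSpace.single j (1 : ℝ))).HasTemperateGrowth := by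
    fun_prop
  have h3 : (fun x : Plane => x j).HasTemperateGrowth := by
    simpa [EuclideanSpace.inner_single_right] using h1
  fun_prop

theorem lineDeriv_lineDeriv_fourier (ψ : 𝓢(Plane, ℂ)) (j : Fin 2) :
    ∂_{EuclideanSpace.single j (1 : ℝ)} (∂_{EuclideanSpace.single j (1 : ℝ)} (𝓕 ψ)) =
      𝓕 (SchwartzMap.smulLeftCLM ℂ (fun ξ : Plane => ((-(4 * Real.pi ^ 2 * ξ j ^ 2) : ℝ) : ℂ)) ψ) := by
  rw [SchwartzMap.lineDerivOp_fourier_eq, SchwartzMap.lineDerivOp_fourier_eq]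
  congr 1
  ext ξ
  have h1 : (fun x : Plane => inner ℝ x (EuclideanSpace.single j (1 : ℝ))).HasTemperateGrowth := by
    fun_prop
  simp only [smul_apply, SchwartzMap.smulLeftCLM_apply_apply h1,
    SchwartzMap.smulLeftCLM_apply_apply (hasTemperateGrowth_coord_sq j)]
  simp [EuclideanSpace.inner_single_right]
  ring_nf
  simp

/-- If `G ∈ L²`, `f ∈ L¹` and `Δ G = -∂₁² f` weakly, then `G = R₁² f` in the weak sense. -/
theorem integral_fourier_mul_eq_of_weak_laplacian {f G : Plane → ℂ} (hf : Integrable f volume)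
    (hG : MemLp G 2 volume)
    (h : ∀ φ : 𝓢(Plane, ℂ),
      ∫ x, (∂_{EuclideanSpace.single (0 : Fin 2) (1 : ℝ)}
          (∂_{EuclideanSpace.single (0 : Fin 2) (1 : ℝ)} φ) +
        ∂_{EuclideanSpace.single (1 : Fin 2) (1 : ℝ)}
          (∂_{EuclideanSpace.single (1 : Fin 2) (1 : ℝ)} φ)) x * G x =
      -∫ x, (∂_{EuclideanSpace.single (0 : Fin 2) (1 : ℝ)}
          (∂_{EuclideanSpace.single (0 : Fin 2) (1 : ℝ)} φ)) x * f x) (ψ : 𝓢(Plane, ℂ)) :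
    ∫ x, 𝓕 ψ x * G x = ∫ ξ, ψ ξ * (rieszSymbol ξ * (rieszSymbol ξ * 𝓕 f ξ)) := by
  set Gh : Lp ℂ 2 (volume : Measure Plane) := 𝓕 hG.toLp with hGh
  set q : Fin 2 → Plane → ℂ := fun j ξ => ((-(4 * Real.pi ^ 2 * ξ j ^ 2) : ℝ) : ℂ) with hq
  have hqt : ∀ j, (q j).HasTemperateGrowth := hasTemperateGrowth_coord_sq
  have hT : Represents G (Lp.toTemperedDistribution hG.toLp) :=
    (represents_toTemperedDistribution _).congr_ae hG.coeFn_toLp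
  have hGrep : Represents Gh (𝓕 (Lp.toTemperedDistribution hG.toLp)) := by
    rw [Lp.fourier_toTemperedDistribution_eq]
    exact represents_toTemperedDistribution _
  have key : ∀ ψ : 𝓢(Plane, ℂ), ∫ x, 𝓕 ψ x * G x = ∫ ξ, ψ ξ * Gh ξ := by
    intro ψ
    rw [← (hT _).2, ← (hGrep _).2, TemperedDistribution.fourier_apply]
  obtain ⟨Tf, hTf⟩ := exists_represents_of_memLp (memLp_one_iff_integrable.2 hf)
  have hfrep := represents_fourier_of_integrable hf hTf
  have keyf : ∀ ψ : 𝓢(Plane, ℂ), ∫ x, 𝓕 ψ x * f x = ∫ ξ, ψ ξ * 𝓕 f ξ := by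
    intro ψ
    rw [← (hTf _).2, ← (hfrep _).2, TemperedDistribution.fourier_apply]
  have hcont : Continuous (𝓕 f) :=
    VectorFourier.fourierIntegral_continuous Real.continuous_fourierChar
      continuous_inner hf
  have hqc : ∀ j, Continuous (q j) := fun j => (hqt j).1.continuous
  -- The Fourier side of `Δ G = -∂₁² f`, with `q j` the symbol of the second derivative in direction
  -- `j`. Since `G ∈ L²`, its transform is a function and cannot charge the origin, so no harmonic
  -- remainder survives the division by `|ξ|²`.
  have hae : ∀ᵐ ξ ∂(volume : Measure Plane), (q 0 ξ + q 1 ξ) * Gh ξ + q 0 ξ * 𝓕 f ξ = 0 := by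
    apply ae_eq_zero_of_integral_contDiff_smul_eq_zero
    · refine LocallyIntegrable.add ?_ ?_
      · have := ((Lp.memLp Gh).locallyIntegrable (by norm_num)).continuous_smul ((hqc 0).add (hqc 1))
        simpa using this
      · exact ((hqc 0).mul hcont).locallyIntegrable
    · intro g g_smooth g_cpt
      have hg₁ : HasCompactSupport (Complex.ofRealCLM ∘ g) := g_cpt.comp_left rfl
      have hg₂ : ContDiff ℝ (⊤ : ℕ∞) (Complex.ofRealCLM ∘ g) := by fun_prop
      set χ : 𝓢(Plane, ℂ) := hg₁.toSchwartzMap hg₂ with hχ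
      have hχa : ∀ x, χ x = (g x : ℂ) := fun x => rfl
      have h' := h (𝓕 χ)
      rw [lineDeriv_lineDeriv_fourier, lineDeriv_lineDeriv_fourier, ← FourierTransform.fourier_add,
        key, keyf] at h'
      have i1 := (hGrep (SchwartzMap.smulLeftCLM ℂ (q 0) χ + SchwartzMap.smulLeftCLM ℂ (q 1) χ)).1
      have i2 := (hfrep (SchwartzMap.smulLeftCLM ℂ (q 0) χ)).1
      have e : ∀ ξ, g ξ • ((q 0 ξ + q 1 ξ) * Gh ξ + q 0 ξ * 𝓕 f ξ) =
          (SchwartzMap.smulLeftCLM ℂ (q 0) χ + SchwartzMap.smulLeftCLM ℂ (q 1) χ) ξ * Gh ξ +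
          SchwartzMap.smulLeftCLM ℂ (q 0) χ ξ * 𝓕 f ξ := by
        intro ξ
        simp only [add_apply, SchwartzMap.smulLeftCLM_apply_apply (hqt _), hχa, smul_eq_mul,
          Complex.real_smul]
        ring
      simp_rw [e]
      rw [integral_add i1 i2, h']
      ring
  rw [key]
  refine integral_congr_ae ?_
  have hne : ∀ᵐ ξ ∂(volume : Measure Plane), ξ ≠ 0 := by
    simp [ae_iff]
  filter_upwards [hae, hne] with ξ h1 h2
  have hn : (‖ξ‖ : ℝ) ^ 2 = ξ 0 ^ 2 + ξ 1 ^ 2 := by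
    rw [EuclideanSpace.real_norm_sq_eq, Fin.sum_univ_two]
  have hn0 : (‖ξ‖ : ℝ) ≠ 0 := norm_ne_zero_iff.2 h2
  congr 1
  rw [← mul_assoc, rieszSymbol_mul_self, div_pow, hn]
  have hn1 : (ξ 0 ^ 2 + ξ 1 ^ 2 : ℂ) ≠ 0 := by
    have : (ξ 0 ^ 2 + ξ 1 ^ 2 : ℝ) ≠ 0 := by rw [← hn]; positivity
    exact_mod_cast this
  have hpi : (Real.pi : ℂ) ≠ 0 := by exact_mod_cast Real.pi_ne_zero
  simp only [hq] at h1
  push_cast at h1 ⊢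
  have h3 : (-(4 * (Real.pi : ℂ) ^ 2)) * ((ξ 0 ^ 2 + ξ 1 ^ 2 : ℂ) * Gh ξ + ξ 0 ^ 2 * 𝓕 f ξ) = 0 := by
    rw [← h1]; ring
  have h4 := (mul_eq_zero.1 h3).resolve_left (by simp)
  field_simp
  linear_combination h4

/-! ### Integration by parts -/

theorem lineDeriv_comm (m n : Plane) (φ : 𝓢(Plane, ℂ)) :
    ∂_{m} (∂_{n} φ) = ∂_{n} (∂_{m} φ) := by
  ext x
  have h : ∀ m n : Plane, (∂_{m} (∂_{n} φ) : 𝓢(Plane, ℂ)) x = fderiv ℝ (fderiv ℝ φ) x m n := by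
    intro m n
    have hd : DifferentiableAt ℝ (fderiv ℝ φ) x :=
      ((φ.smooth 2).fderiv_right (m := 1) (by norm_num)).differentiable (by norm_num) x
    change fderiv ℝ (fun y => fderiv ℝ φ y n) x m = _
    rw [fderiv_clm_apply hd (by fun_prop)]
    simp
  rw [h, h]
  exact ((φ.smooth 2).contDiffAt.isSymmSndFDerivAt (by simp)).eq m n

theorem integral_lineDeriv_mul_eq_neg {v v' : Plane → ℂ} {m : Plane} {C C' : ℝ}
    (hv : ∀ x, HasLineDerivAt ℝ v (v' x) x m) (hvm : AEStronglyMeasurable v volume)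
    (hvb : ∀ x, ‖v x‖ ≤ C) (hvm' : AEStronglyMeasurable v' volume) (hvb' : ∀ x, ‖v' x‖ ≤ C')
    (φ : 𝓢(Plane, ℂ)) :
    ∫ x, (∂_{m} φ : 𝓢(Plane, ℂ)) x * v x = -∫ x, φ x * v' x := by
  have hφ : ∀ x, HasLineDerivAt ℝ φ ((∂_{m} φ : 𝓢(Plane, ℂ)) x) x m := by
    intro x
    exact (φ.hasFDerivAt x).hasLineDerivAt m
  have h := integral_bilinear_hasLineDerivAt_right_eq_neg_left_of_integrable
    (B := (ContinuousLinearMap.mul ℝ ℂ)) (f := v) (f' := v') (g := φ)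
    (g' := (∂_{m} φ : 𝓢(Plane, ℂ))) (v := m) (μ := volume) (φ.integrable.bdd_mul hvm' (.of_forall hvb'))
    ((∂_{m} φ : 𝓢(Plane, ℂ)).integrable.bdd_mul hvm (.of_forall hvb))
    (φ.integrable.bdd_mul hvm (.of_forall hvb)) (fun x _ => hv x) (fun x _ => hφ x)
  simpa [mul_comm] using h

/-- If `(v, w)` is a bounded curl-free field, then `f = div (v, w)` and `G = -∂₁ v` satisfy
`Δ G = -∂₁² f` weakly. -/
theorem weak_laplacian_of_curl_free {v w v₀ v₁ w₁ : Plane → ℂ} {C : ℝ}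
    (hv₀ : ∀ x, HasLineDerivAt ℝ v (v₀ x) x (EuclideanSpace.single (0 : Fin 2) (1 : ℝ)))
    (hv₁ : ∀ x, HasLineDerivAt ℝ v (v₁ x) x (EuclideanSpace.single (1 : Fin 2) (1 : ℝ)))
    (hw₀ : ∀ x, HasLineDerivAt ℝ w (v₁ x) x (EuclideanSpace.single (0 : Fin 2) (1 : ℝ)))
    (hw₁ : ∀ x, HasLineDerivAt ℝ w (w₁ x) x (EuclideanSpace.single (1 : Fin 2) (1 : ℝ)))
    (mv : AEStronglyMeasurable v volume) (mw : AEStronglyMeasurable w volume)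
    (mv₀ : AEStronglyMeasurable v₀ volume) (mv₁ : AEStronglyMeasurable v₁ volume)
    (mw₁ : AEStronglyMeasurable w₁ volume) (bv : ∀ x, ‖v x‖ ≤ C) (bw : ∀ x, ‖w x‖ ≤ C)
    (bv₀ : ∀ x, ‖v₀ x‖ ≤ C) (bv₁ : ∀ x, ‖v₁ x‖ ≤ C) (bw₁ : ∀ x, ‖w₁ x‖ ≤ C) (φ : 𝓢(Plane, ℂ)) :
    ∫ x, (∂_{EuclideanSpace.single (0 : Fin 2) (1 : ℝ)}
          (∂_{EuclideanSpace.single (0 : Fin 2) (1 : ℝ)} φ) +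
        ∂_{EuclideanSpace.single (1 : Fin 2) (1 : ℝ)}
          (∂_{EuclideanSpace.single (1 : Fin 2) (1 : ℝ)} φ)) x * (-v₀ x) =
      -∫ x, (∂_{EuclideanSpace.single (0 : Fin 2) (1 : ℝ)}
          (∂_{EuclideanSpace.single (0 : Fin 2) (1 : ℝ)} φ)) x * (v₀ x + w₁ x) := by
  set e₀ : Plane := EuclideanSpace.single (0 : Fin 2) (1 : ℝ)
  set e₁ : Plane := EuclideanSpace.single (1 : Fin 2) (1 : ℝ)
  have hcomm : ∀ χ : 𝓢(Plane, ℂ), ∂_{e₀} (∂_{e₁} χ) = ∂_{e₁} (∂_{e₀} χ) :=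
    fun χ => lineDeriv_comm _ _ _
  -- The shared mixed derivative `v₁` links the two sides: `∫ ∂₁∂₁φ v₀ = ∫ ∂₀∂₁φ v₁ = ∫ ∂₀∂₀φ w₁`
  -- (indices from 0), by integrating by parts back and forth.
  have k1 := integral_lineDeriv_mul_eq_neg hv₀ mv bv mv₀ bv₀ (∂_{e₁} (∂_{e₁} φ))
  have k2 := integral_lineDeriv_mul_eq_neg hv₁ mv bv mv₁ bv₁ (∂_{e₀} (∂_{e₁} φ))
  have k3 := integral_lineDeriv_mul_eq_neg hw₀ mw bw mv₁ bv₁ (∂_{e₀} (∂_{e₁} φ))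
  have k4 := integral_lineDeriv_mul_eq_neg hw₁ mw bw mw₁ bw₁ (∂_{e₀} (∂_{e₀} φ))
  rw [hcomm (∂_{e₁} φ)] at k1
  rw [← hcomm, ← hcomm φ] at k4
  have i1 : Integrable (fun x => (∂_{e₀} (∂_{e₀} φ)) x * v₀ x) volume :=
    (∂_{e₀} (∂_{e₀} φ)).integrable.mul_bdd mv₀ (.of_forall bv₀)
  have i2 : Integrable (fun x => (∂_{e₁} (∂_{e₁} φ)) x * v₀ x) volume :=
    (∂_{e₁} (∂_{e₁} φ)).integrable.mul_bdd mv₀ (.of_forall bv₀)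
  have i3 : Integrable (fun x => (∂_{e₀} (∂_{e₀} φ)) x * w₁ x) volume :=
    (∂_{e₀} (∂_{e₀} φ)).integrable.mul_bdd mw₁ (.of_forall bw₁)
  simp only [add_apply, mul_neg, integral_neg, add_mul, mul_add]
  rw [integral_add i1 i2, integral_add i1 i3]
  linear_combination -k1 + k2 - k3 + k4

/-! ### The radial profile -/

/-- Radial factor of the gradient of the potential of the bump `max (1 - |z|²) 0`, as a function
of `s = |z|²`. -/
def radialFactor (s : ℝ) : ℝ := if s ≤ 1 then 1 / 2 - s / 4 else 1 / (4 * s)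

/-- The derivative of `radialFactor`. -/
def radialFactor' (s : ℝ) : ℝ := if s ≤ 1 then -(1 / 4) else -(1 / (4 * s ^ 2))

/-- At `s = 1` both branches have value `1/4` and slope `-1/4`, so the gluing is `C¹` and the unit
circle contributes no boundary term. -/
theorem hasDerivAt_radialFactor (s : ℝ) : HasDerivAt radialFactor (radialFactor' s) s := by
  have hl : ∀ t : ℝ, HasDerivAt (fun s : ℝ => 1 / 2 - s / 4) (-(1 / 4)) t := by
    intro t
    exact (((hasDerivAt_id t).div_const 4).const_sub (1 / 2)).congr_deriv (by norm_num)
  have hr : ∀ t : ℝ, 0 < t → HasDerivAt (fun s : ℝ => 1 / (4 * s)) (-(1 / (4 * t ^ 2))) t := by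
    intro t ht
    have h := ((hasDerivAt_id t).const_mul 4).fun_inv (by simpa using ht.ne')
    simp only [id, mul_one] at h
    simp only [one_div]
    refine h.congr_deriv ?_
    field_simp
  rcases lt_trichotomy s 1 with h | rfl | h
  · have e : radialFactor =ᶠ[nhds s] fun s => 1 / 2 - s / 4 := by
      filter_upwards [Iio_mem_nhds h] with t ht
      simp [radialFactor, (show t ≤ 1 from le_of_lt ht)]
    have e' : radialFactor' s = -(1 / 4) := by simp [radialFactor', h.le]
    rw [e']
    exact (hl s).congr_of_eventuallyEq e
  · have h1 : HasDerivWithinAt radialFactor (radialFactor' 1) (Set.Iic 1) 1 := by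
      have e' : radialFactor' 1 = -(1 / 4) := by simp [radialFactor']
      rw [e']
      exact (hl 1).hasDerivWithinAt.congr (fun t ht => by simp [radialFactor, Set.mem_Iic.1 ht])
        (by simp [radialFactor])
    have h2 : HasDerivWithinAt radialFactor (radialFactor' 1) (Set.Ici 1) 1 := by
      have e' : radialFactor' 1 = -(1 / (4 * 1 ^ 2)) := by simp [radialFactor']
      rw [e']
      refine (hr 1 one_pos).hasDerivWithinAt.congr (fun t ht => ?_) (by norm_num [radialFactor])
      rcases (Set.mem_Ici.1 ht).eq_or_lt with rfl | h
      · norm_num [radialFactor]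
      · simp [radialFactor, h.not_ge]
    have h3 := h1.union h2
    rwa [Set.Iic_union_Ici, hasDerivWithinAt_univ] at h3
  · have e : radialFactor =ᶠ[nhds s] fun s => 1 / (4 * s) := by
      filter_upwards [Ioi_mem_nhds h] with t ht
      simp [radialFactor, (show ¬ t ≤ 1 from not_le.2 ht)]
    have e' : radialFactor' s = -(1 / (4 * s ^ 2)) := by simp [radialFactor', h.not_ge]
    rw [e']
    exact (hr s (by linarith)).congr_of_eventuallyEq e

theorem measurable_radialFactor' : Measurable radialFactor' := by
  unfold radialFactor'
  exact Measurable.ite measurableSet_Iic (by fun_prop) (by fun_prop)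

theorem continuous_radialFactor : Continuous radialFactor :=
  continuous_iff_continuousAt.2 fun s => (hasDerivAt_radialFactor s).continuousAt

/-- The gradient of the potential of the bump. -/
def bumpField (j : Fin 2) (z : Plane) : ℝ := z j * radialFactor (‖z‖ ^ 2)

/-- The bump `max (1 - |z|²) 0`. -/
def bump (z : Plane) : ℝ := max (1 - ‖z‖ ^ 2) 0

/-- The image of the bump under `R₁²`. -/
def bumpResponse (z : Plane) : ℝ :=
  -(radialFactor (‖z‖ ^ 2) + 2 * z 0 ^ 2 * radialFactor' (‖z‖ ^ 2))

theorem norm_sq_eq (z : Plane) : ‖z‖ ^ 2 = z 0 ^ 2 + z 1 ^ 2 := by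
  rw [EuclideanSpace.real_norm_sq_eq, Fin.sum_univ_two]

/-- The derivative is symmetric in `i` and `j`: the field is curl-free, as
`weak_laplacian_of_curl_free` demands. -/
theorem hasLineDerivAt_bumpField (i j : Fin 2) (z : Plane) :
    HasLineDerivAt ℝ (bumpField i)
      ((if i = j then 1 else 0) * radialFactor (‖z‖ ^ 2) +
        2 * z i * z j * radialFactor' (‖z‖ ^ 2)) z (EuclideanSpace.single j 1) := by
  unfold HasLineDerivAt bumpField
  have h1 : HasDerivAt (fun t : ℝ => ‖z + t • EuclideanSpace.single j (1 : ℝ)‖ ^ 2) (2 * z j) 0 := by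
    have e : ∀ t : ℝ, ‖z + t • EuclideanSpace.single j (1 : ℝ)‖ ^ 2 =
        ‖z‖ ^ 2 + 2 * z j * t + t ^ 2 := by
      intro t
      rw [norm_add_sq_real, inner_smul_right, norm_smul]
      simp [EuclideanSpace.inner_single_right]
      ring
    simp_rw [e]
    have := ((hasDerivAt_id (0 : ℝ)).const_mul (2 * z j)).const_add (‖z‖ ^ 2) |>.add
      ((hasDerivAt_id (0 : ℝ)).pow 2)
    simpa using! this
  have h2 : HasDerivAt (fun t : ℝ => (z + t • EuclideanSpace.single j (1 : ℝ)) i)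
      (if i = j then 1 else 0) 0 := by
    simp only [PiLp.add_apply, PiLp.smul_apply, PiLp.single_apply, smul_eq_mul]
    have := ((hasDerivAt_id (0 : ℝ)).mul_const (if i = j then (1 : ℝ) else 0)).const_add (z i)
    simpa using this
  have h3 := (hasDerivAt_radialFactor (‖z‖ ^ 2)).comp_of_eq 0 h1 (by simp)
  have h4 := h2.mul h3
  simp only [Function.comp_def, zero_smul, add_zero] at h4
  refine h4.congr_deriv ?_
  ring

theorem radialFactor_of_le {s : ℝ} (h : s ≤ 1) : radialFactor s = 1 / 2 - s / 4 := by
  simp [radialFactor, h]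

theorem radialFactor_of_ge {s : ℝ} (h : 1 ≤ s) : radialFactor s = 1 / (4 * s) := by
  rcases h.eq_or_lt with rfl | h
  · norm_num [radialFactor]
  · simp [radialFactor, h.not_ge]

theorem radialFactor'_of_le {s : ℝ} (h : s ≤ 1) : radialFactor' s = -(1 / 4) := by
  simp [radialFactor', h]

theorem radialFactor'_of_ge {s : ℝ} (h : 1 ≤ s) : radialFactor' s = -(1 / (4 * s ^ 2)) := by
  rcases h.eq_or_lt with rfl | h
  · norm_num [radialFactor']
  · simp [radialFactor', h.not_ge]

/-- The right side is the divergence of `bumpField`; the profile `φ` solves `2φ + 2sφ' = max(1 - s,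
0)`. -/
theorem bump_eq (z : Plane) : bump z = radialFactor (‖z‖ ^ 2) + 2 * z 0 ^ 2 * radialFactor' (‖z‖ ^ 2)
    + (radialFactor (‖z‖ ^ 2) + 2 * z 1 ^ 2 * radialFactor' (‖z‖ ^ 2)) := by
  have hz := norm_sq_eq z
  unfold bump
  set s := ‖z‖ ^ 2
  rcases le_total s 1 with h | h
  · rw [radialFactor_of_le h, radialFactor'_of_le h, max_eq_left (by linarith)]
    linarith
  · rw [radialFactor_of_ge h, radialFactor'_of_ge h, max_eq_right (by linarith)]
    have : z 1 ^ 2 = s - z 0 ^ 2 := by linarith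
    rw [this]
    field_simp
    ring

theorem radialFactor_nonneg {s : ℝ} (_hs : 0 ≤ s) : 0 ≤ radialFactor s := by
  rcases le_total s 1 with h | h
  · rw [radialFactor_of_le h]; linarith
  · rw [radialFactor_of_ge h]; positivity

theorem radialFactor_le {s : ℝ} (hs : 0 ≤ s) : radialFactor s ≤ 1 / (1 + s) := by
  rcases le_total s 1 with h | h
  · rw [radialFactor_of_le h, le_div_iff₀ (by linarith)]; nlinarith
  · rw [radialFactor_of_ge h]
    exact one_div_le_one_div_of_le (by linarith) (by linarith)

theorem abs_mul_radialFactor'_le {s a : ℝ} (hs : 0 ≤ s) (ha : |a| ≤ s) :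
    |2 * a * radialFactor' s| ≤ 1 / (1 + s) := by
  have h2 : 0 ≤ |a| := abs_nonneg a
  rcases le_total s 1 with h | h
  · rw [radialFactor'_of_le h, abs_mul, abs_mul, abs_neg, abs_of_pos (by norm_num : (0 : ℝ) < 1 / 4),
      abs_two, le_div_iff₀ (by linarith)]
    nlinarith
  · rw [radialFactor'_of_ge h, abs_mul, abs_mul, abs_neg, abs_two,
      abs_of_pos (by positivity : (0 : ℝ) < 1 / (4 * s ^ 2))]
    calc 2 * |a| * (1 / (4 * s ^ 2)) ≤ 2 * s * (1 / (4 * s ^ 2)) := by gcongr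
      _ = 1 / (2 * s) := by field_simp; norm_num
      _ ≤ 1 / (1 + s) := one_div_le_one_div_of_le (by linarith) (by linarith)

theorem abs_coord_mul_le (z : Plane) (i j : Fin 2) : |z i * z j| ≤ ‖z‖ ^ 2 := by
  have h : ∀ i, |z i| ≤ ‖z‖ := fun i => by simpa using PiLp.norm_apply_le z i
  rw [abs_mul, pow_two]
  exact mul_le_mul (h i) (h j) (abs_nonneg _) (norm_nonneg _)

theorem abs_bumpField_deriv_le (z : Plane) (i j : Fin 2) :
    |(if i = j then 1 else 0) * radialFactor (‖z‖ ^ 2) + 2 * z i * z j * radialFactor' (‖z‖ ^ 2)| ≤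
      2 / (1 + ‖z‖ ^ 2) := by
  have hs : 0 ≤ ‖z‖ ^ 2 := by positivity
  refine (abs_add_le _ _).trans ?_
  have h1 : |(if i = j then 1 else 0) * radialFactor (‖z‖ ^ 2)| ≤ 1 / (1 + ‖z‖ ^ 2) := by
    split_ifs
    · rw [one_mul, abs_of_nonneg (radialFactor_nonneg hs)]; exact radialFactor_le hs
    · rw [zero_mul, abs_zero]; positivity
  have h2 := abs_mul_radialFactor'_le hs (abs_coord_mul_le z i j)
  rw [← mul_assoc] at h2
  calc _ ≤ 1 / (1 + ‖z‖ ^ 2) + 1 / (1 + ‖z‖ ^ 2) := add_le_add h1 h2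
    _ = _ := by ring

theorem abs_bumpField_le (z : Plane) (i : Fin 2) : |bumpField i z| ≤ 1 := by
  have hs : 0 ≤ ‖z‖ ^ 2 := by positivity
  have h : |z i| ≤ ‖z‖ := by simpa using PiLp.norm_apply_le z i
  rw [bumpField, abs_mul, abs_of_nonneg (radialFactor_nonneg hs)]
  calc |z i| * radialFactor (‖z‖ ^ 2) ≤ ‖z‖ * (1 / (1 + ‖z‖ ^ 2)) :=
        mul_le_mul h (radialFactor_le hs) (radialFactor_nonneg hs) (norm_nonneg _)
    _ ≤ 1 := by
      rw [mul_one_div]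
      exact div_le_one_of_le₀ (by nlinarith [sq_nonneg (‖z‖ - 1)]) (by positivity)

/-- Decay of order `|z|⁻²` gives `L^p` for every `p > 1`, but does not suffice for `L¹` in the
plane. -/
theorem abs_bumpResponse_le (z : Plane) : |bumpResponse z| ≤ 2 / (1 + ‖z‖ ^ 2) := by
  have h := abs_bumpField_deriv_le z 0 0
  simp only [if_true, one_mul] at h
  rw [bumpResponse, abs_neg]
  convert h using 3
  ring

theorem measurable_bumpResponse : Measurable bumpResponse := by
  unfold bumpResponse
  have h : Measurable fun ξ : Plane => ξ 0 := by fun_prop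
  have h1 : Measurable fun ξ : Plane => ‖ξ‖ ^ 2 := by fun_prop
  exact ((continuous_radialFactor.measurable.comp h1).add
    (((h.pow_const 2).const_mul 2).mul (measurable_radialFactor'.comp h1))).neg

theorem continuous_bump : Continuous bump := by unfold bump; fun_prop

theorem bump_nonneg (z : Plane) : 0 ≤ bump z := le_max_right _ _

theorem bump_le_one (z : Plane) : bump z ≤ 1 := max_le (by nlinarith [sq_nonneg ‖z‖]) zero_le_one

theorem bump_eq_zero {z : Plane} (h : 1 ≤ ‖z‖) : bump z = 0 :=
  max_eq_right (by nlinarith)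

/-- The self-interaction is worst at the centre, where it equals `-1/2`. -/
theorem neg_half_le_bumpResponse {z : Plane} (h : ‖z‖ ≤ 1) : -(1 / 2) ≤ bumpResponse z := by
  have h1 : ‖z‖ ^ 2 ≤ 1 := pow_le_one₀ (norm_nonneg _) h
  rw [bumpResponse, radialFactor_of_le h1, radialFactor'_of_le h1]
  nlinarith [sq_nonneg (z 0), sq_nonneg ‖z‖]

/-- Outside its disc a radial bump acts like a point mass, so this is a multiple of the kernel of
`R₁²`. -/
theorem bumpResponse_of_one_le {z : Plane} (h : 1 ≤ ‖z‖) :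
    bumpResponse z = (z 0 ^ 2 - z 1 ^ 2) / (4 * (‖z‖ ^ 2) ^ 2) := by
  have h1 : 1 ≤ ‖z‖ ^ 2 := one_le_pow₀ h
  have hz := norm_sq_eq z
  rw [bumpResponse, radialFactor_of_ge h1, radialFactor'_of_ge h1]
  set s := ‖z‖ ^ 2
  have : z 1 ^ 2 = s - z 0 ^ 2 := by linarith
  rw [this]
  field_simp
  ring

/-! ### Rescaled bumps -/

theorem integrable_bumpResponse_rpow {p : ℝ} (hp : 1 < p) :
    Integrable (fun z => |bumpResponse z| ^ p) volume := by
  have h0 : Integrable (fun z : Plane => 4 ^ p * (1 + ‖z‖) ^ (-(2 * p))) volume :=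
    (integrable_one_add_norm (by simp; linarith)).const_mul _
  refine h0.mono' (measurable_bumpResponse.abs.pow_const p).aestronglyMeasurable
    (.of_forall fun z => ?_)
  rw [Real.norm_of_nonneg (by positivity)]
  have h1 : |bumpResponse z| ≤ 4 * ((1 + ‖z‖) ^ 2)⁻¹ := by
    refine (abs_bumpResponse_le z).trans ?_
    rw [← div_eq_mul_inv, div_le_div_iff₀ (by positivity) (by positivity)]
    nlinarith [sq_nonneg (‖z‖ - 1)]
  calc |bumpResponse z| ^ p ≤ (4 * ((1 + ‖z‖) ^ 2)⁻¹) ^ p := by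
        gcongr
    _ = _ := by
      rw [Real.mul_rpow (by norm_num) (by positivity), Real.inv_rpow (by positivity),
        Real.rpow_neg (by positivity), Real.rpow_mul (by positivity), Real.rpow_two]

theorem integrable_comp_rescale {F : Plane → ℝ} (hF : Integrable F volume) (y : Plane) {r : ℝ}
    (hr : 0 < r) : Integrable (fun x => F (r⁻¹ • (x - y))) volume := by
  have h := (integrable_comp_smul_iff volume F (inv_ne_zero hr.ne')).2 hF
  exact h.comp_sub_right y

theorem integral_comp_rescale (F : Plane → ℝ) (y : Plane) {r : ℝ} (hr : 0 < r) :
    ∫ x, F (r⁻¹ • (x - y)) = r ^ 2 * ∫ x, F x := by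
  rw [integral_sub_right_eq_self (fun x => F (r⁻¹ • x)) y, Measure.integral_comp_inv_smul_of_nonneg _ _ hr.le]
  simp

theorem measurable_rescale (y : Plane) (r : ℝ) : Measurable fun x : Plane => r⁻¹ • (x - y) := by
  fun_prop

theorem integrable_bump : Integrable bump volume := by
  refine continuous_bump.integrable_of_hasCompactSupport ?_
  refine HasCompactSupport.intro (isCompact_closedBall (0 : Plane) 1) fun z hz => bump_eq_zero ?_
  have : ¬ ‖z‖ ≤ 1 := by simpa using hz
  linarith

theorem hasLineDerivAt_rescale {F : Plane → ℝ} {F' : ℝ} {x y e : Plane} {r : ℝ} (hr : 0 < r)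
    (h : HasLineDerivAt ℝ F F' (r⁻¹ • (x - y)) e) :
    HasLineDerivAt ℝ (fun x => ((r * F (r⁻¹ • (x - y)) : ℝ) : ℂ)) (F' : ℂ) x e := by
  unfold HasLineDerivAt at h ⊢
  have h1 : HasDerivAt (fun t : ℝ => r⁻¹ * t) r⁻¹ 0 := by
    simpa using (hasDerivAt_id (0 : ℝ)).const_mul r⁻¹
  have h2 := ((h.comp_of_eq 0 h1 (by simp)).const_mul r).ofReal_comp
  have e1 : r * (F' * r⁻¹) = F' := by field_simp
  rw [e1] at h2
  refine h2.congr_of_eventuallyEq (.of_forall fun t => ?_)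
  have e2 : r⁻¹ • (x + t • e - y) = r⁻¹ • (x - y) + (r⁻¹ * t) • e := by module
  simp only [e2, Function.comp_apply]

/-- The weak identity `R₁² (bump) = bumpResponse` for rescaled bumps. -/
theorem integral_fourier_mul_bumpResponse (y : Plane) {r : ℝ} (hr : 0 < r) (ψ : 𝓢(Plane, ℂ)) :
    ∫ x, 𝓕 ψ x * (bumpResponse (r⁻¹ • (x - y)) : ℂ) =
      ∫ ξ, ψ ξ * (rieszSymbol ξ * (rieszSymbol ξ *
        𝓕 (fun x => (bump (r⁻¹ • (x - y)) : ℂ)) ξ)) := by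
  have hA := measurable_rescale y r
  have hc : ∀ i : Fin 2, Measurable fun ξ : Plane => ξ i := fun i => by fun_prop
  have hn : Measurable fun ξ : Plane => ‖ξ‖ ^ 2 := by fun_prop
  have mF : ∀ i, Measurable (bumpField i) := fun i =>
    (hc i).mul (continuous_radialFactor.measurable.comp hn)
  have mD : ∀ i j : Fin 2, Measurable fun z : Plane =>
      (if i = j then (1 : ℝ) else 0) * radialFactor (‖z‖ ^ 2) +
        2 * z i * z j * radialFactor' (‖z‖ ^ 2) := fun i j =>
    ((continuous_radialFactor.measurable.comp hn).const_mul _).add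
      ((((hc i).const_mul 2).mul (hc j)).mul (measurable_radialFactor'.comp hn))
  have bF : ∀ i x, ‖((r * bumpField i (r⁻¹ • (x - y)) : ℝ) : ℂ)‖ ≤ r + 2 := by
    intro i x
    rw [Complex.norm_real, Real.norm_eq_abs, abs_mul, abs_of_pos hr]
    nlinarith [abs_bumpField_le (r⁻¹ • (x - y)) i]
  have bD : ∀ (i j : Fin 2) (z : Plane), ‖(((if i = j then (1 : ℝ) else 0) * radialFactor (‖z‖ ^ 2) +
        2 * z i * z j * radialFactor' (‖z‖ ^ 2) : ℝ) : ℂ)‖ ≤ r + 2 := by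
    intro i j z
    rw [Complex.norm_real, Real.norm_eq_abs]
    refine (abs_bumpField_deriv_le z i j).trans ?_
    have : 2 / (1 + ‖z‖ ^ 2) ≤ 2 := div_le_self (by norm_num) (by nlinarith [sq_nonneg ‖z‖])
    linarith
  have key := weak_laplacian_of_curl_free (C := r + 2)
    (fun x => hasLineDerivAt_rescale hr (hasLineDerivAt_bumpField 0 0 (r⁻¹ • (x - y))))
    (fun x => hasLineDerivAt_rescale hr (hasLineDerivAt_bumpField 0 1 (r⁻¹ • (x - y))))
    (fun x => by
      have h := hasLineDerivAt_rescale hr (hasLineDerivAt_bumpField 1 0 (r⁻¹ • (x - y)))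
      convert h using 2
      simp only [Fin.isValue, zero_ne_one, one_ne_zero, if_false]
      ring)
    (fun x => hasLineDerivAt_rescale hr (hasLineDerivAt_bumpField 1 1 (r⁻¹ • (x - y))))
    (Complex.measurable_ofReal.comp (((mF 0).comp hA).const_mul r)).aestronglyMeasurable
    (Complex.measurable_ofReal.comp (((mF 1).comp hA).const_mul r)).aestronglyMeasurable
    (Complex.measurable_ofReal.comp ((mD 0 0).comp hA)).aestronglyMeasurable
    (Complex.measurable_ofReal.comp ((mD 0 1).comp hA)).aestronglyMeasurable
    (Complex.measurable_ofReal.comp ((mD 1 1).comp hA)).aestronglyMeasurable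
    (bF 0) (bF 1) (fun _ => bD 0 0 _) (fun _ => bD 0 1 _) (fun _ => bD 1 1 _)
  refine integral_fourier_mul_eq_of_weak_laplacian
    (integrable_comp_rescale integrable_bump y hr).ofReal ?_ (fun φ => ?_) ψ
  · have h : MemLp (fun x => bumpResponse (r⁻¹ • (x - y))) 2 volume := by
      have hm : AEStronglyMeasurable (fun x => bumpResponse (r⁻¹ • (x - y))) volume :=
        (measurable_bumpResponse.comp hA).aestronglyMeasurable
      rw [memLp_two_iff_integrable_sq hm]
      have := integrable_comp_rescale (integrable_bumpResponse_rpow one_lt_two) y hr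
      simpa using this
    exact h.ofReal
  · have h := key φ
    convert h using 5 with x x
    · rw [bumpResponse, ← Complex.ofReal_neg, if_pos rfl]
      congr 1
      ring
    · have e := bump_eq (r⁻¹ • (x - y))
      simp only [if_true, one_mul, mul_assoc, ← pow_two] at e ⊢
      rw [e]
      exact Complex.ofReal_add _ _

/-- A bound on the pairing of a rescaled response with a Schwartz function. -/
theorem exists_integral_norm_mul_bumpResponse_le {p q : ℝ} (hpq : p.HolderConjugate q)
    (φ : 𝓢(Plane, ℂ)) : ∃ C : ℝ, ∀ (y : Plane) (r : ℝ), 0 < r →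
      Integrable (fun x => φ x * (bumpResponse (r⁻¹ • (x - y)) : ℂ)) volume ∧
      ∫ x, ‖φ x * (bumpResponse (r⁻¹ • (x - y)) : ℂ)‖ ≤ C * r ^ (2 / p) := by
  have hφ : Integrable (fun x => ‖φ x‖ ^ q) volume := by
    have h := (φ.memLp (ENNReal.ofReal q) volume).integrable_norm_rpow
      (by simpa using hpq.symm.pos) (by simp)
    rwa [ENNReal.toReal_ofReal hpq.symm.nonneg] at h
  refine ⟨(∫ x, ‖φ x‖ ^ q) / q + (∫ z, |bumpResponse z| ^ p) / p, fun y r hr => ?_⟩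
  have hA := measurable_rescale y r
  have hi : Integrable (fun x => φ x * (bumpResponse (r⁻¹ • (x - y)) : ℂ)) volume := by
    refine φ.integrable.mul_bdd (c := 2)
      (Complex.measurable_ofReal.comp (measurable_bumpResponse.comp hA)).aestronglyMeasurable
      (.of_forall fun x => ?_)
    rw [Complex.norm_real, Real.norm_eq_abs]
    exact (abs_bumpResponse_le _).trans (div_le_self (by norm_num) (by simp))
  refine ⟨hi, ?_⟩
  have hb := integrable_comp_rescale (integrable_bumpResponse_rpow hpq.lt) y hr
  have hr2 : 0 < r ^ (2 / p) := Real.rpow_pos_of_pos hr _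
  have hrp : (r ^ (2 / p)) ^ p = r ^ 2 := by
    rw [← Real.rpow_mul hr.le, div_mul_cancel₀ _ hpq.ne_zero, Real.rpow_two]
  -- Young's inequality after normalising by `r^(2/p)`, the scaling of the `L^p` norm of the
  -- rescaled response; this makes the constant independent of `y` and `r`.
  calc ∫ x, ‖φ x * (bumpResponse (r⁻¹ • (x - y)) : ℂ)‖
      ≤ ∫ x, r ^ (2 / p) * (‖φ x‖ ^ q / q + (r ^ 2)⁻¹ * (|bumpResponse (r⁻¹ • (x - y))| ^ p / p)) := by
        refine integral_mono hi.norm (((hφ.div_const q).add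
          ((hb.div_const p).const_mul _)).const_mul _) fun x => ?_
        have hy := Real.young_inequality_of_nonneg (norm_nonneg (φ x))
          (div_nonneg (abs_nonneg (bumpResponse (r⁻¹ • (x - y)))) hr2.le) hpq.symm
        rw [Real.div_rpow (abs_nonneg _) hr2.le, hrp] at hy
        simp only [norm_mul, Complex.norm_real, Real.norm_eq_abs]
        calc ‖φ x‖ * |bumpResponse (r⁻¹ • (x - y))| =
            r ^ (2 / p) * (‖φ x‖ * (|bumpResponse (r⁻¹ • (x - y))| / r ^ (2 / p))) := by
              field_simp
          _ ≤ _ := by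
            refine mul_le_mul_of_nonneg_left (hy.trans (le_of_eq ?_)) hr2.le
            ring
    _ = _ := by
      rw [integral_const_mul, integral_add (hφ.div_const q) ((hb.div_const p).const_mul _),
        integral_const_mul, integral_div, integral_div,
        integral_comp_rescale (fun z => |bumpResponse z| ^ p) y hr]
      field_simp

/-! ### Superpositions of rescaled bumps -/

theorem integrable_tsum {ι α E : Type*} [Countable ι] [MeasurableSpace α] {μ : Measure α}
    [NormedAddCommGroup E] [CompleteSpace E] {F : ι → α → E} (hF : ∀ i, Integrable (F i) μ)
    (hs : Summable fun i => ∫ a, ‖F i a‖ ∂μ) : Integrable (fun a => ∑' i, F i a) μ := by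
  have hfin : ∑' i, ∫⁻ a, ‖F i a‖ₑ ∂μ ≠ ∞ := by
    have h (i : ι) : ∫⁻ a, ‖F i a‖ₑ ∂μ = ENNReal.ofReal (∫ a, ‖F i a‖ ∂μ) :=
      (ofReal_integral_norm_eq_lintegral_enorm (hF i)).symm
    simp_rw [h]
    rw [← ENNReal.ofReal_tsum_of_nonneg (fun i => integral_nonneg fun _ => norm_nonneg _) hs]
    exact ENNReal.ofReal_ne_top
  rw [← lintegral_tsum fun i => (hF i).1.enorm] at hfin
  have hm : AEMeasurable (fun a => ∑' i, ‖F i a‖ₑ) μ := AEMeasurable.tsum fun i => (hF i).1.enorm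
  have hsum : ∀ᵐ a ∂μ, HasSum (fun i => F i a) (∑' i, F i a) := by
    filter_upwards [ae_lt_top' hm hfin] with a ha
    refine Summable.hasSum (Summable.of_norm ?_)
    have h : ∀ i, ‖F i a‖ₑ = ((‖F i a‖₊ : NNReal) : ℝ≥0∞) := fun i => rfl
    simp_rw [h] at ha
    exact NNReal.summable_coe.2 (ENNReal.tsum_coe_ne_top_iff_summable.1 ha.ne)
  refine ⟨aestronglyMeasurable_of_tendsto_ae Filter.atTop (f := fun s a => ∑ i ∈ s, F i a)
    (fun s => Finset.aestronglyMeasurable_fun_sum s fun i _ => (hF i).1) hsum, ?_⟩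
  rw [hasFiniteIntegral_iff_enorm]
  exact (lintegral_mono fun a => enorm_tsum_le_tsum_enorm).trans_lt (lt_top_iff_ne_top.2 hfin)

section Superposition

variable {ι : Type*} (c r : ι → ℝ) (y : ι → Plane)

/-- A superposition of rescaled bumps. -/
def bumpSum (x : Plane) : ℝ := ∑' i, c i * bump ((r i)⁻¹ • (x - y i))

/-- The corresponding superposition of responses. -/
def responseSum (x : Plane) : ℝ := ∑' i, c i * bumpResponse ((r i)⁻¹ • (x - y i))

variable {c r y}

theorem integral_norm_mul_bump (hc : ∀ i, 0 ≤ c i) (hr : ∀ i, 0 < r i) (i : ι) :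
    ∫ x, ‖c i * bump ((r i)⁻¹ • (x - y i))‖ = (∫ z, bump z) * (c i * r i ^ 2) := by
  have h : ∀ x, ‖c i * bump ((r i)⁻¹ • (x - y i))‖ = c i * bump ((r i)⁻¹ • (x - y i)) := fun x =>
    Real.norm_of_nonneg (mul_nonneg (hc i) (bump_nonneg _))
  simp_rw [h]
  rw [integral_const_mul, integral_comp_rescale bump _ (hr i)]
  ring

theorem integrable_const_mul_bump (hr : ∀ i, 0 < r i) (i : ι) :
    Integrable (fun x => c i * bump ((r i)⁻¹ • (x - y i))) volume :=
  (integrable_comp_rescale integrable_bump (y i) (hr i)).const_mul _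

theorem integrable_bumpSum [Countable ι] (hc : ∀ i, 0 ≤ c i) (hr : ∀ i, 0 < r i)
    (hs : Summable fun i => c i * r i ^ 2) : Integrable (bumpSum c r y) volume := by
  refine integrable_tsum (integrable_const_mul_bump hr) ?_
  simp_rw [integral_norm_mul_bump hc hr]
  exact hs.mul_left _

/-- The weak identity is summed over the bumps: `c r²` controls the `L¹` norms of the bumps, and `c
r^(2/p)` controls the pairings of the responses with a Schwartz function. -/
theorem isRieszOneSq_bumpSum [Countable ι] {p q : ℝ} (hpq : p.HolderConjugate q)
    (hc : ∀ i, 0 ≤ c i) (hr : ∀ i, 0 < r i) (hs : Summable fun i => c i * r i ^ 2)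
    (hs' : Summable fun i => c i * r i ^ (2 / p)) :
    IsRieszOneSq (fun x => (bumpSum c r y x : ℂ)) (fun x => (responseSum c r y x : ℂ)) := by
  have hW := integrable_bumpSum (y := y) hc hr hs
  have eW : ∀ (φ : ℂ) (x : Plane), φ * (bumpSum c r y x : ℂ) =
      ∑' i, φ * (c i * bump ((r i)⁻¹ • (x - y i)) : ℝ) := by
    intro φ x
    rw [bumpSum, Complex.ofReal_tsum, tsum_mul_left]
  have eg : ∀ (φ : ℂ) (x : Plane), φ * (responseSum c r y x : ℂ) =
      ∑' i, c i * (φ * (bumpResponse ((r i)⁻¹ • (x - y i)) : ℂ)) := by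
    intro φ x
    rw [responseSum, Complex.ofReal_tsum, ← tsum_mul_left]
    refine tsum_congr fun i => ?_
    push_cast
    ring
  have hint : ∀ φ : 𝓢(Plane, ℂ), (∀ i, Integrable (fun x =>
      (c i : ℂ) * (φ x * (bumpResponse ((r i)⁻¹ • (x - y i)) : ℂ))) volume) ∧
      Summable fun i => ∫ x, ‖(c i : ℂ) * (φ x * (bumpResponse ((r i)⁻¹ • (x - y i)) : ℂ))‖ := by
    intro φ
    obtain ⟨C, hC⟩ := exists_integral_norm_mul_bumpResponse_le hpq φ
    refine ⟨fun i => ((hC (y i) (r i) (hr i)).1).const_mul _, ?_⟩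
    refine Summable.of_nonneg_of_le (fun i => integral_nonneg fun _ => norm_nonneg _) (fun i => ?_)
      (hs'.mul_left C)
    have h : ∀ x, ‖(c i : ℂ) * (φ x * (bumpResponse ((r i)⁻¹ • (x - y i)) : ℂ))‖ =
        c i * ‖φ x * (bumpResponse ((r i)⁻¹ • (x - y i)) : ℂ)‖ := by
      intro x
      rw [norm_mul, Complex.norm_real, Real.norm_of_nonneg (hc i)]
    simp_rw [h]
    rw [integral_const_mul]
    calc _ ≤ c i * (C * r i ^ (2 / p)) :=
          mul_le_mul_of_nonneg_left (hC (y i) (r i) (hr i)).2 (hc i)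
      _ = _ := by ring
  refine isRieszOneSq_of_integral_eq hW.ofReal (fun φ => ?_) (fun ψ => ?_)
  · simp_rw [eg]
    exact integrable_tsum (hint φ).1 (hint φ).2
  -- Moving the symbol onto the test function destroys smoothness at the origin, but `χ` stays
  -- integrable and `𝓕 χ` bounded, which suffices against an `L¹` sum.
  · set χ : Plane → ℂ := fun ξ => rieszSymbol ξ * (rieszSymbol ξ * ψ ξ) with hχ
    have hχi : Integrable χ volume := memLp_one_iff_integrable.1
      (memLp_rieszSymbol_mul (memLp_rieszSymbol_mul (memLp_one_iff_integrable.2 ψ.integrable)))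
    have flip : ∀ f : Plane → ℂ, Integrable f volume →
        ∫ ξ, ψ ξ * (rieszSymbol ξ * (rieszSymbol ξ * 𝓕 f ξ)) = ∫ x, 𝓕 χ x * f x := by
      intro f hf
      have h : ∫ x, 𝓕 χ x * f x = ∫ ξ, χ ξ * 𝓕 f ξ := by
        simpa using! VectorFourier.integral_bilin_fourierIntegral_eq_flip (.mul ℂ ℂ)
          (L := innerₗ Plane) Real.continuous_fourierChar continuous_inner hχi hf
      rw [h]
      congr 1 with ξ
      simp only [hχ]
      ring
    have hcont : Continuous (𝓕 χ) :=
      VectorFourier.fourierIntegral_continuous Real.continuous_fourierChar continuous_inner hχi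
    have hbd : ∀ x, ‖𝓕 χ x‖ ≤ ∫ ξ, ‖χ ξ‖ := fun x =>
      VectorFourier.norm_fourierIntegral_le_integral_norm _ _ _ _ _
    have hbi : ∀ i, Integrable (fun x => 𝓕 χ x * ((c i * bump ((r i)⁻¹ • (x - y i)) : ℝ) : ℂ))
        volume := fun i =>
      (integrable_const_mul_bump hr i).ofReal.bdd_mul hcont.aestronglyMeasurable (.of_forall hbd)
    have hWc : Integrable (fun x => (bumpSum c r y x : ℂ)) volume := hW.ofReal
    have hbc : ∀ i, Integrable (fun x => (bump ((r i)⁻¹ • (x - y i)) : ℂ)) volume := fun i =>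
      (integrable_comp_rescale integrable_bump (y i) (hr i)).ofReal
    rw [flip _ hWc]
    simp_rw [eg, eW]
    rw [← integral_tsum_of_summable_integral_norm (hint (𝓕 ψ)).1 (hint (𝓕 ψ)).2,
      ← integral_tsum_of_summable_integral_norm hbi]
    · refine tsum_congr fun i => ?_
      rw [integral_const_mul, integral_fourier_mul_bumpResponse (y i) (hr i) ψ,
        flip _ (hbc i), ← integral_const_mul]
      congr 1 with x
      push_cast
      ring
    · refine Summable.of_nonneg_of_le (fun i => integral_nonneg fun _ => norm_nonneg _) (fun i => ?_)
        ((hs.mul_left (∫ z, bump z)).mul_left (∫ ξ, ‖χ ξ‖))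
      rw [← integral_norm_mul_bump (y := y) hc hr, ← integral_const_mul]
      refine integral_mono (hbi i).norm ((integrable_const_mul_bump hr i).norm.const_mul _) fun x => ?_
      simp only [norm_mul, Complex.norm_real]
      exact mul_le_mul_of_nonneg_right (hbd x) (by positivity)

/-- The bumps have pairwise disjoint supports. -/
def DisjointDiscs (r : ι → ℝ) (y : ι → Plane) : Prop :=
  ∀ i j x, ‖x - y i‖ ≤ r i → ‖x - y j‖ ≤ r j → i = j

theorem one_le_norm_rescale {r : ℝ} (hr : 0 < r) {x y : Plane} :
    1 ≤ ‖r⁻¹ • (x - y)‖ ↔ r ≤ ‖x - y‖ := by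
  rw [norm_smul, norm_inv, Real.norm_of_nonneg hr.le, ← div_eq_inv_mul, one_le_div hr]

theorem norm_rescale_le_one {r : ℝ} (hr : 0 < r) {x y : Plane} :
    ‖r⁻¹ • (x - y)‖ ≤ 1 ↔ ‖x - y‖ ≤ r := by
  rw [norm_smul, norm_inv, Real.norm_of_nonneg hr.le, ← div_eq_inv_mul, div_le_one hr]

theorem bumpSum_eq_of_mem (hr : ∀ i, 0 < r i) (hd : DisjointDiscs r y) {i : ι} {x : Plane}
    (hx : ‖x - y i‖ ≤ r i) : bumpSum c r y x = c i * bump ((r i)⁻¹ • (x - y i)) := by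
  refine tsum_eq_single i fun j hj => ?_
  rw [bump_eq_zero, mul_zero]
  rw [one_le_norm_rescale (hr j)]
  by_contra h
  exact hj (hd j i x (not_le.1 h).le hx)

theorem bumpSum_eq_zero (hr : ∀ i, 0 < r i) {x : Plane} (hx : ∀ i, r i < ‖x - y i‖) :
    bumpSum c r y x = 0 := by
  have h : ∀ i, c i * bump ((r i)⁻¹ • (x - y i)) = 0 := fun i => by
    rw [bump_eq_zero, mul_zero]
    exact (one_le_norm_rescale (hr i)).2 (hx i).le
  simp [bumpSum, h]

theorem bumpSum_nonneg (hc : ∀ i, 0 ≤ c i) (x : Plane) : 0 ≤ bumpSum c r y x :=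
  tsum_nonneg fun i => mul_nonneg (hc i) (bump_nonneg _)

/-- On disjoint discs the `p`-th power of the sum is the sum of the `p`-th powers, each with
integral a constant times `c^p r²`. -/
theorem memLp_bumpSum [Countable ι] {p : ℝ} (hp : 1 < p) (hc : ∀ i, 0 ≤ c i) (hr : ∀ i, 0 < r i)
    (hs : Summable fun i => c i * r i ^ 2) (hd : DisjointDiscs r y)
    (hs' : Summable fun i => c i ^ p * r i ^ 2) :
    MemLp (bumpSum c r y) (ENNReal.ofReal p) volume := by
  have hW := integrable_bumpSum (y := y) hc hr hs
  have hp0 : 0 < p := by linarith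
  rw [← integrable_norm_rpow_iff hW.1 (by simpa using hp0) (by simp),
    ENNReal.toReal_ofReal hp0.le]
  have e : (fun x => ‖bumpSum c r y x‖ ^ p) =
      fun x => ∑' i, c i ^ p * bump ((r i)⁻¹ • (x - y i)) ^ p := by
    funext x
    rw [Real.norm_of_nonneg (bumpSum_nonneg hc x)]
    have hz : ∀ i, r i < ‖x - y i‖ → c i ^ p * bump ((r i)⁻¹ • (x - y i)) ^ p = 0 := fun i hi => by
      rw [bump_eq_zero ((one_le_norm_rescale (hr i)).2 hi.le), Real.zero_rpow hp0.ne', mul_zero]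
    by_cases hx : ∃ i, ‖x - y i‖ ≤ r i
    · obtain ⟨i, hi⟩ := hx
      rw [bumpSum_eq_of_mem hr hd hi, Real.mul_rpow (hc i) (bump_nonneg _), tsum_eq_single i]
      intro j hj
      refine hz j ?_
      by_contra h
      exact hj (hd j i x (not_lt.1 h) hi)
    · push Not at hx
      rw [bumpSum_eq_zero hr hx, Real.zero_rpow hp0.ne']
      simp [hz _ (hx _)]
  rw [e]
  have hb : Integrable (fun z => bump z ^ p) volume := by
    refine integrable_bump.mono' (by
      exact (continuous_bump.rpow_const fun _ => .inr hp0.le).aestronglyMeasurable)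
      (.of_forall fun z => ?_)
    rw [Real.norm_of_nonneg (Real.rpow_nonneg (bump_nonneg z) p)]
    calc bump z ^ p ≤ bump z ^ (1 : ℝ) :=
          Real.rpow_le_rpow_of_exponent_ge_of_imp (bump_nonneg z) (bump_le_one z) hp.le
            (fun _ h => absurd h hp0.ne')
      _ = bump z := Real.rpow_one _
  have hi : ∀ i, Integrable (fun x => c i ^ p * bump ((r i)⁻¹ • (x - y i)) ^ p) volume := fun i =>
    (integrable_comp_rescale hb (y i) (hr i)).const_mul _
  refine integrable_tsum hi ?_
  have hn : ∀ i, ∫ x, ‖c i ^ p * bump ((r i)⁻¹ • (x - y i)) ^ p‖ =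
      (∫ z, bump z ^ p) * (c i ^ p * r i ^ 2) := by
    intro i
    have h : ∀ x, ‖c i ^ p * bump ((r i)⁻¹ • (x - y i)) ^ p‖ =
        c i ^ p * bump ((r i)⁻¹ • (x - y i)) ^ p := fun x =>
      Real.norm_of_nonneg (mul_nonneg (Real.rpow_nonneg (hc i) _)
        (Real.rpow_nonneg (bump_nonneg _) _))
    simp_rw [h]
    rw [integral_const_mul, integral_comp_rescale (fun z => bump z ^ p) _ (hr i)]
    ring
  simp_rw [hn]
  exact hs'.mul_left _

theorem integral_bump_sq_pos : 0 < ∫ z, bump z ^ 2 := by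
  have hb : Integrable (fun z => bump z ^ 2) volume := by
    refine integrable_bump.mono' (by
      exact (continuous_bump.pow 2).aestronglyMeasurable) (.of_forall fun z => ?_)
    rw [Real.norm_of_nonneg (sq_nonneg _)]
    nlinarith [bump_nonneg z, bump_le_one z]
  refine (integral_pos_iff_support_of_nonneg (fun z => sq_nonneg _) hb).2 ?_
  refine (continuous_bump.pow 2).isOpen_support.measure_pos _ ⟨0, ?_⟩
  simp [bump]

/-- If discs inside a ball carry unbounded square masses, the superposition is not square
integrable on that ball. -/
theorem not_memLp_two_bumpSum (hr : ∀ i, 0 < r i) (hd : DisjointDiscs r y) {B : Set Plane}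
    (s : ℕ → ι) (hB : ∀ k, Metric.closedBall (y (s k)) (r (s k)) ⊆ B)
    (hs : Filter.Tendsto (fun k => c (s k) ^ 2 * r (s k) ^ 2) Filter.atTop Filter.atTop) :
    ¬ MemLp (bumpSum c r y) 2 (volume.restrict B) := by
  intro h
  have hi : IntegrableOn (fun x => bumpSum c r y x ^ 2) B volume :=
    (memLp_two_iff_integrable_sq h.1).1 h
  have hle : ∀ k, (∫ z, bump z ^ 2) * (c (s k) ^ 2 * r (s k) ^ 2) ≤
      ∫ x in B, bumpSum c r y x ^ 2 := by
    intro k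
    have e1 : ∫ x in Metric.closedBall (y (s k)) (r (s k)), bumpSum c r y x ^ 2 =
        (∫ z, bump z ^ 2) * (c (s k) ^ 2 * r (s k) ^ 2) := by
      rw [setIntegral_congr_fun (g := fun x =>
        (c (s k) * bump ((r (s k))⁻¹ • (x - y (s k)))) ^ 2) measurableSet_closedBall,
        setIntegral_eq_integral_of_forall_compl_eq_zero]
      · simp_rw [mul_pow]
        rw [integral_const_mul, integral_comp_rescale (fun z => bump z ^ 2) _ (hr _)]
        ring
      · intro x hx
        rw [bump_eq_zero]
        · simp
        · rw [one_le_norm_rescale (hr _)]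
          have : ¬ ‖x - y (s k)‖ ≤ r (s k) := by
            simpa [Metric.mem_closedBall, dist_eq_norm] using hx
          linarith
      · intro x hx
        have : ‖x - y (s k)‖ ≤ r (s k) := by
          simpa [Metric.mem_closedBall, dist_eq_norm] using hx
        simp only [bumpSum_eq_of_mem hr hd this]
    rw [← e1]
    exact setIntegral_mono_set hi (.of_forall fun x => sq_nonneg _) (hB k).eventuallyLE
  have ht := hs.const_mul_atTop integral_bump_sq_pos
  obtain ⟨k, hk⟩ := (ht.eventually_gt_atTop (∫ x in B, bumpSum c r y x ^ 2)).exists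
  exact absurd (hle k) (not_le.2 hk)

end Superposition

/-! ### The configuration of discs

Cluster `n` sits at height `2⁻ⁿ` and consists of discs shrinking horizontally towards the tip
`(0, 2⁻ⁿ)`. The mass of a cluster concentrates at its tip, which every disc of the cluster sees in
the horizontal direction, where the kernel of `R₁²` is positive. -/

/-- The centres of the discs. -/
def discCenter (i : ℕ × ℕ) : Plane :=
  !₂[(1 / 2) ^ i.1 * (1 / 2) ^ i.2 / 100, (1 / 2) ^ i.1]

/-- The radii of the discs. -/
def discRadius (i : ℕ × ℕ) : ℝ := (1 / 2) ^ i.1 * (1 / 2) ^ i.2 / 800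

/-- The heights of the bumps. -/
def discCoeff (i : ℕ × ℕ) : ℝ := 2 ^ i.1 * (999 / 250) ^ i.2

theorem discRadius_pos (i : ℕ × ℕ) : 0 < discRadius i := by unfold discRadius; positivity

theorem discCoeff_pos (i : ℕ × ℕ) : 0 < discCoeff i := by unfold discCoeff; positivity

@[simp] theorem discCenter_zero (i : ℕ × ℕ) :
    discCenter i 0 = (1 / 2) ^ i.1 * (1 / 2) ^ i.2 / 100 := rfl

@[simp] theorem discCenter_one (i : ℕ × ℕ) : discCenter i 1 = (1 / 2) ^ i.1 := rfl

theorem half_pow_le_of_lt {m n : ℕ} (h : m < n) : (1 / 2 : ℝ) ^ n ≤ (1 / 2) ^ m / 2 := by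
  calc (1 / 2 : ℝ) ^ n ≤ (1 / 2) ^ (m + 1) := pow_le_pow_of_le_one (by norm_num) (by norm_num) h
    _ = _ := by rw [pow_succ]; ring

theorem half_pow_le_one (n : ℕ) : (1 / 2 : ℝ) ^ n ≤ 1 := pow_le_one₀ (by norm_num) (by norm_num)

theorem half_pow_pos (n : ℕ) : 0 < (1 / 2 : ℝ) ^ n := by positivity

theorem abs_coord_le_norm (z : Plane) (j : Fin 2) : |z j| ≤ ‖z‖ := by
  simpa using PiLp.norm_apply_le z j

theorem abs_coord_sub_le_of_mem_disc {i : ℕ × ℕ} {x : Plane} (hx : ‖x - discCenter i‖ ≤ discRadius i) :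
    |x 0 - (1 / 2) ^ i.1 * (1 / 2) ^ i.2 / 100| ≤ (1 / 2) ^ i.1 * (1 / 2) ^ i.2 / 800 ∧
      |x 1 - (1 / 2) ^ i.1| ≤ (1 / 2) ^ i.1 * (1 / 2) ^ i.2 / 800 :=
  ⟨(abs_coord_le_norm (x - discCenter i) 0).trans hx,
    (abs_coord_le_norm (x - discCenter i) 1).trans hx⟩

/-- Clusters are separated by height, discs of one cluster by abscissa: successive values halve, and
the radius is at most an eighth of either coordinate of the centre. -/
theorem disjointDiscs : DisjointDiscs discRadius discCenter := by
  have key1 : ∀ i j : ℕ × ℕ, ∀ x : Plane, ‖x - discCenter i‖ ≤ discRadius i →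
      ‖x - discCenter j‖ ≤ discRadius j → ¬ i.1 < j.1 := by
    intro i j x hi hj h
    have h1 := abs_le.1 (abs_coord_sub_le_of_mem_disc hi).2
    have h2 := abs_le.1 (abs_coord_sub_le_of_mem_disc hj).2
    have h3 := half_pow_le_of_lt h
    have a0 := half_pow_pos i.1
    have b0 := half_pow_pos j.1
    have a1 := mul_le_of_le_one_right a0.le (half_pow_le_one i.2)
    have b1 := mul_le_of_le_one_right b0.le (half_pow_le_one j.2)
    linarith [h1.1, h2.2]
  have key2 : ∀ n k l : ℕ, ∀ x : Plane, ‖x - discCenter (n, k)‖ ≤ discRadius (n, k) →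
      ‖x - discCenter (n, l)‖ ≤ discRadius (n, l) → ¬ k < l := by
    intro n k l x hi hj h
    have h1 := abs_le.1 (abs_coord_sub_le_of_mem_disc hi).1
    have h2 := abs_le.1 (abs_coord_sub_le_of_mem_disc hj).1
    simp only at h1 h2
    have h3 := mul_le_mul_of_nonneg_left (half_pow_le_of_lt h) (half_pow_pos n).le
    have := mul_pos (half_pow_pos n) (half_pow_pos k)
    linarith [h1.1, h2.2]
  rintro ⟨n, k⟩ ⟨m, l⟩ x hi hj
  obtain rfl : n = m := le_antisymm (not_lt.1 (key1 _ _ x hj hi)) (not_lt.1 (key1 _ _ x hi hj))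
  rw [Prod.mk.injEq]
  exact ⟨rfl, le_antisymm (not_lt.1 (key2 _ _ _ x hj hi)) (not_lt.1 (key2 _ _ _ x hi hj))⟩

/-! ### Summability -/

/-- The mass of a disc up to a constant. The ratio `999/250 = 4 · 999/1000` is below 4, so a cluster
has finite mass; close to 4, so the smaller discs together carry 999 times the mass of a given one;
and above 2, so the `L²` masses grow. -/
theorem discCoeff_mul_discRadius_sq (i : ℕ × ℕ) :
    discCoeff i * discRadius i ^ 2 = 1 / 640000 * ((1 / 2) ^ i.1 * (999 / 1000) ^ i.2) := by
  have h1 : (1 / 2 : ℝ) ^ i.1 = 2 ^ i.1 * ((1 / 2) ^ i.1) ^ 2 := by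
    rw [← pow_mul, mul_comm i.1, pow_mul, ← mul_pow]; norm_num
  have h2 : (999 / 1000 : ℝ) ^ i.2 = (999 / 250) ^ i.2 * ((1 / 2) ^ i.2) ^ 2 := by
    rw [← pow_mul, mul_comm i.2, pow_mul, ← mul_pow]; norm_num
  rw [h2, discCoeff, discRadius]
  linear_combination (-(1 / 640000) * ((999 / 250) ^ i.2 * ((1 / 2) ^ i.2) ^ 2)) * h1

theorem summable_geometric_prod {a b : ℝ} (ha : 0 ≤ a) (ha' : a < 1) (hb : 0 ≤ b) (hb' : b < 1) :
    Summable fun i : ℕ × ℕ => a ^ i.1 * b ^ i.2 :=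
  (summable_geometric_of_lt_one ha ha').mul_of_nonneg (summable_geometric_of_lt_one hb hb')
    (fun _ => by positivity) (fun _ => by positivity)

theorem summable_discCoeff_mul_sq : Summable fun i => discCoeff i * discRadius i ^ 2 := by
  simp_rw [discCoeff_mul_discRadius_sq]
  exact (summable_geometric_prod (by norm_num) (by norm_num) (by norm_num) (by norm_num)).mul_left _

/-- This fixes the exponent `p = 3000/2999`. The claim amounts to `4 < (1000/999)^3000`, which
Bernoulli gives because `1 + 3000/999 > 4`. -/
theorem lt_four_rpow : (999 / 250 : ℝ) < 4 ^ (2999 / 3000 : ℝ) := by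
  have h1 : (4 : ℝ) < (1000 / 999) ^ 3000 := by
    rw [show (1000 / 999 : ℝ) = 1 + 1 / 999 by norm_num]
    exact lt_of_lt_of_le (by norm_num) (one_add_mul_le_pow (a := (1 / 999 : ℝ)) (by norm_num) 3000)
  have h2 : (4 : ℝ) ^ (1 / 3000 : ℝ) < 1000 / 999 := by
    have h := Real.rpow_lt_rpow (by norm_num) h1 (by norm_num : (0 : ℝ) < 1 / 3000)
    rwa [← Real.rpow_natCast, ← Real.rpow_mul (by norm_num), Nat.cast_ofNat,
      show (3000 : ℝ) * (1 / 3000) = 1 by norm_num, Real.rpow_one] at h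
  have h3 : (4 : ℝ) ^ (2999 / 3000 : ℝ) * 4 ^ (1 / 3000 : ℝ) = 4 := by
    rw [← Real.rpow_add (by norm_num)]; norm_num
  have h4 : (0 : ℝ) < 4 ^ (2999 / 3000 : ℝ) := Real.rpow_pos_of_pos (by norm_num) _
  nlinarith

theorem two_lt_four_rpow : (2 : ℝ) < 4 ^ (2999 / 3000 : ℝ) := by
  linarith [lt_four_rpow]

theorem holderConjugate_exponent : (3000 / 2999 : ℝ).HolderConjugate 3000 := by
  rw [Real.holderConjugate_iff]
  norm_num

theorem summable_discCoeff_mul_rpow :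
    Summable fun i => discCoeff i * discRadius i ^ (2 / (3000 / 2999) : ℝ) := by
  set u : ℝ := 4 ^ (2999 / 3000 : ℝ) with hu
  have hu0 : 0 < u := Real.rpow_pos_of_pos (by norm_num) _
  have e : (1 / 2 : ℝ) ^ (2 / (3000 / 2999) : ℝ) = u⁻¹ := by
    rw [hu, show (2 / (3000 / 2999) : ℝ) = 2 * (2999 / 3000) by norm_num,
      Real.rpow_mul (by norm_num), ← Real.inv_rpow (by norm_num)]
    norm_num
  have h : ∀ i : ℕ × ℕ, discCoeff i * discRadius i ^ (2 / (3000 / 2999) : ℝ) =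
      (1 / 800 : ℝ) ^ (2 / (3000 / 2999) : ℝ) * ((2 * u⁻¹) ^ i.1 * (999 / 250 * u⁻¹) ^ i.2) := by
    intro i
    rw [discRadius, div_eq_mul_one_div, Real.mul_rpow (by positivity) (by norm_num),
      Real.mul_rpow (by positivity) (by positivity), ← Real.rpow_pow_comm (by norm_num),
      ← Real.rpow_pow_comm (by norm_num), e, discCoeff, mul_pow, mul_pow]
    ring
  simp_rw [h]
  clear_value u
  refine (summable_geometric_prod (by positivity) ?_ (by positivity) ?_).mul_left _
  · rw [← div_eq_mul_inv, div_lt_one hu0, hu]; exact two_lt_four_rpow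
  · rw [← div_eq_mul_inv, div_lt_one hu0, hu]; exact lt_four_rpow

theorem summable_discCoeff_rpow_mul_sq :
    Summable fun i => discCoeff i ^ (3000 / 2999 : ℝ) * discRadius i ^ 2 := by
  have h4 : ((4 : ℝ) ^ (2999 / 3000 : ℝ)) ^ (3000 / 2999 : ℝ) = 4 := by
    rw [← Real.rpow_mul (by norm_num)]; norm_num
  have ha : (2 : ℝ) ^ (3000 / 2999 : ℝ) < 4 := by
    rw [← h4]; exact Real.rpow_lt_rpow (by norm_num) two_lt_four_rpow (by norm_num)
  have hb : (999 / 250 : ℝ) ^ (3000 / 2999 : ℝ) < 4 := by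
    rw [← h4]; exact Real.rpow_lt_rpow (by norm_num) lt_four_rpow (by norm_num)
  have h : ∀ i : ℕ × ℕ, discCoeff i ^ (3000 / 2999 : ℝ) * discRadius i ^ 2 =
      1 / 640000 * (((2 : ℝ) ^ (3000 / 2999 : ℝ) * (1 / 4)) ^ i.1 *
        ((999 / 250 : ℝ) ^ (3000 / 2999 : ℝ) * (1 / 4)) ^ i.2) := by
    intro i
    have e : ∀ n : ℕ, (1 / 4 : ℝ) ^ n = ((1 / 2) ^ n) ^ 2 := fun n => by
      rw [← pow_mul, mul_comm n, pow_mul]; norm_num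
    rw [discCoeff, Real.mul_rpow (by positivity) (by positivity), ← Real.rpow_pow_comm (by norm_num),
      ← Real.rpow_pow_comm (by norm_num), mul_pow, mul_pow, e, e, discRadius]
    ring
  simp_rw [h]
  have ha0 : 0 ≤ (2 : ℝ) ^ (3000 / 2999 : ℝ) := Real.rpow_nonneg (by norm_num) _
  have hb0 : 0 ≤ (999 / 250 : ℝ) ^ (3000 / 2999 : ℝ) := Real.rpow_nonneg (by norm_num) _
  exact (summable_geometric_prod (mul_nonneg ha0 (by norm_num)) (by linarith)
    (mul_nonneg hb0 (by norm_num)) (by linarith)).mul_left _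

/-! ### Positivity of the response on the discs -/

theorem bumpResponse_rescale {r : ℝ} (hr : 0 < r) {x y : Plane} (h : r ≤ ‖x - y‖) :
    bumpResponse (r⁻¹ • (x - y)) =
      r ^ 2 * (((x 0 - y 0) ^ 2 - (x 1 - y 1) ^ 2) /
        (4 * ((x 0 - y 0) ^ 2 + (x 1 - y 1) ^ 2) ^ 2)) := by
  have hn := norm_sq_eq (x - y)
  have hpos : 0 < ‖x - y‖ := hr.trans_le h
  rw [bumpResponse_of_one_le ((one_le_norm_rescale hr).2 h), norm_smul, norm_inv,
    Real.norm_of_nonneg hr.le, mul_pow, hn]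
  simp only [PiLp.sub_apply] at hn
  have : 0 < (x 0 - y 0) ^ 2 + (x 1 - y 1) ^ 2 := by rw [← hn]; positivity
  simp only [PiLp.smul_apply, PiLp.sub_apply, smul_eq_mul, mul_pow]
  field_simp

theorem abs_bumpResponse_rescale_le {r d : ℝ} (hr : 0 < r) (hd : 0 < d) {x y : Plane}
    (h : d ≤ ‖x - y‖) : |bumpResponse (r⁻¹ • (x - y))| ≤ 2 * r ^ 2 / d ^ 2 := by
  refine (abs_bumpResponse_le _).trans ?_
  rw [norm_smul, norm_inv, Real.norm_of_nonneg hr.le, mul_pow, div_le_div_iff₀ (by positivity)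
    (by positivity)]
  have h1 : d ^ 2 ≤ ‖x - y‖ ^ 2 := pow_le_pow_left₀ hd.le h 2
  have h2 : r ^ 2 * (r⁻¹ ^ 2 * ‖x - y‖ ^ 2) = ‖x - y‖ ^ 2 := by field_simp
  nlinarith [sq_nonneg r]

theorem neg_le_bumpResponse_rescale {r d : ℝ} (hr : 0 < r) (hd : 0 < d) {x y : Plane}
    (hrd : r ≤ d) (h : d ≤ ‖x - y‖) : -(r ^ 2 / (4 * d ^ 2)) ≤ bumpResponse (r⁻¹ • (x - y)) := by
  have hn := norm_sq_eq (x - y)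
  simp only [PiLp.sub_apply] at hn
  have h1 : d ^ 2 ≤ ‖x - y‖ ^ 2 := pow_le_pow_left₀ hd.le h 2
  rw [bumpResponse_rescale hr (hrd.trans h), ← hn]
  set s := ‖x - y‖ ^ 2
  have hs : 0 < s := (pow_pos hd 2).trans_le h1
  have h2 : -(1 / (4 * d ^ 2)) ≤ ((x 0 - y 0) ^ 2 - (x 1 - y 1) ^ 2) / (4 * s ^ 2) := by
    have h3 : -(1 / (4 * s)) ≤ ((x 0 - y 0) ^ 2 - (x 1 - y 1) ^ 2) / (4 * s ^ 2) := by
      rw [le_div_iff₀ (by positivity)]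
      have e : -(1 / (4 * s)) * (4 * s ^ 2) = -s := by field_simp
      rw [e]
      nlinarith [sq_nonneg (x 0 - y 0)]
    have h4 : 1 / (4 * s) ≤ 1 / (4 * d ^ 2) := one_div_le_one_div_of_le (by positivity) (by linarith)
    linarith
  calc -(r ^ 2 / (4 * d ^ 2)) = r ^ 2 * -(1 / (4 * d ^ 2)) := by ring
    _ ≤ _ := mul_le_mul_of_nonneg_left h2 (sq_nonneg r)

section OnDisc

variable {n k : ℕ} {x : Plane}

/-- Distinct heights differ by at least half the larger one, and the radius of the disc takes away
only a small part of that. -/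
theorem norm_ge_of_other_cluster (hx : ‖x - discCenter (n, k)‖ ≤ discRadius (n, k)) {m : ℕ}
    (l : ℕ) (hm : m ≠ n) :
    (1 / 2) ^ m / 4 ≤ ‖x - discCenter (m, l)‖ ∧ (1 / 2) ^ n / 4 ≤ ‖x - discCenter (m, l)‖ := by
  have h1 := abs_le.1 (abs_coord_sub_le_of_mem_disc hx).2
  have h2 : |x 1 - (1 / 2) ^ m| ≤ ‖x - discCenter (m, l)‖ :=
    abs_coord_le_norm (x - discCenter (m, l)) 1
  simp only at h1
  have a0 := half_pow_pos n
  have b0 := half_pow_pos m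
  have a1 := mul_le_of_le_one_right a0.le (half_pow_le_one k)
  rcases lt_or_gt_of_ne hm with h | h
  · have h3 := half_pow_le_of_lt h
    have h4 := neg_abs_le (x 1 - (1 / 2) ^ m)
    constructor <;> linarith [h1.2]
  · have h3 := half_pow_le_of_lt h
    have h4 := le_abs_self (x 1 - (1 / 2) ^ m)
    constructor <;> linarith [h1.1]

/-- With `ρ` the radius of disc `k`, its centre has abscissa `8ρ`, that of disc `l` lies between `0`
and `4ρ`, and `x` deviates by at most `ρ`: hence `3ρ` and `9ρ`. -/
theorem coord_bounds_of_smaller_disc (hx : ‖x - discCenter (n, k)‖ ≤ discRadius (n, k)) {l : ℕ}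
    (hl : k < l) :
    3 * ((1 / 2) ^ n * (1 / 2) ^ k / 800) ≤ x 0 - discCenter (n, l) 0 ∧
      x 0 - discCenter (n, l) 0 ≤ 9 * ((1 / 2) ^ n * (1 / 2) ^ k / 800) ∧
      |x 1 - discCenter (n, l) 1| ≤ (1 / 2) ^ n * (1 / 2) ^ k / 800 := by
  obtain ⟨h1, h2⟩ := abs_coord_sub_le_of_mem_disc hx
  rw [abs_le] at h1
  simp only [discCenter_zero, discCenter_one] at h1 h2 ⊢
  have h3 := mul_le_mul_of_nonneg_left (half_pow_le_of_lt hl) (half_pow_pos n).le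
  have h4 := mul_pos (half_pow_pos n) (half_pow_pos l)
  exact ⟨by linarith [h1.1], by linarith [h1.2], h2⟩

theorem coord_bounds_of_larger_disc (hx : ‖x - discCenter (n, k)‖ ≤ discRadius (n, k)) {l : ℕ}
    (hl : l < k) :
    3 * ((1 / 2) ^ n * (1 / 2) ^ k / 800) ≤ |x 0 - discCenter (n, l) 0| ∧
      |x 1 - discCenter (n, l) 1| ≤ (1 / 2) ^ n * (1 / 2) ^ k / 800 := by
  obtain ⟨h1, h2⟩ := abs_coord_sub_le_of_mem_disc hx
  rw [abs_le] at h1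
  simp only [discCenter_zero, discCenter_one] at h1 h2 ⊢
  have h3 := mul_le_mul_of_nonneg_left (half_pow_le_of_lt hl) (half_pow_pos n).le
  have h4 := mul_pos (half_pow_pos n) (half_pow_pos k)
  have h5 := neg_abs_le (x 0 - (1 / 2) ^ n * (1 / 2) ^ l / 100)
  exact ⟨by linarith [h1.2], h2⟩

theorem discRadius_le_norm (hx : ‖x - discCenter (n, k)‖ ≤ discRadius (n, k)) {i : ℕ × ℕ}
    (hi : i ≠ (n, k)) : discRadius (n, k) ≤ ‖x - discCenter i‖ := by
  have hp : 0 < (1 / 2 : ℝ) ^ n * (1 / 2) ^ k / 800 := discRadius_pos (n, k)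
  obtain ⟨m, l⟩ := i
  rw [discRadius]
  simp only
  by_cases hm : m = n
  · subst hm
    have h0 := abs_coord_le_norm (x - discCenter (m, l)) 0
    simp only [PiLp.sub_apply] at h0
    have hl : l ≠ k := fun h => hi (by rw [h])
    rcases lt_or_gt_of_ne hl with h | h
    · linarith [(coord_bounds_of_larger_disc hx h).1]
    · linarith [(coord_bounds_of_smaller_disc hx h).1, le_abs_self (x 0 - discCenter (m, l) 0)]
  · have h1 := (norm_ge_of_other_cluster hx l hm).2
    have a0 := half_pow_pos n
    have a1 := mul_le_of_le_one_right a0.le (half_pow_le_one k)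
    linarith

theorem summable_response_on_disc (hx : ‖x - discCenter (n, k)‖ ≤ discRadius (n, k)) :
    Summable fun i => discCoeff i * bumpResponse ((discRadius i)⁻¹ • (x - discCenter i)) := by
  refine Summable.of_norm_bounded
    (summable_discCoeff_mul_sq.mul_left (2 / discRadius (n, k) ^ 2)) fun i => ?_
  have hr := discRadius_pos (n, k)
  rw [norm_mul, Real.norm_of_nonneg (discCoeff_pos i).le, Real.norm_eq_abs]
  have h : |bumpResponse ((discRadius i)⁻¹ • (x - discCenter i))| ≤
      2 * discRadius i ^ 2 / discRadius (n, k) ^ 2 := by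
    by_cases hi : i = (n, k)
    · rw [hi, mul_div_assoc, div_self (by positivity), mul_one]
      exact (abs_bumpResponse_le _).trans (div_le_self (by norm_num) (by simp))
    · exact abs_bumpResponse_rescale_le (discRadius_pos i) hr (discRadius_le_norm hx hi)
  calc _ ≤ discCoeff i * (2 * discRadius i ^ 2 / discRadius (n, k) ^ 2) :=
        mul_le_mul_of_nonneg_left h (discCoeff_pos i).le
    _ = _ := by ring

theorem response_nonneg_of_larger_disc (hx : ‖x - discCenter (n, k)‖ ≤ discRadius (n, k)) {l : ℕ}
    (hl : l < k) :
    0 ≤ discCoeff (n, l) * bumpResponse ((discRadius (n, l))⁻¹ • (x - discCenter (n, l))) := by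
  refine mul_nonneg (discCoeff_pos _).le ?_
  have hni : ¬ ‖x - discCenter (n, l)‖ ≤ discRadius (n, l) := fun h =>
    hl.ne (Prod.mk.inj (disjointDiscs _ _ x h hx)).2
  rw [bumpResponse_rescale (discRadius_pos _) (not_le.1 hni).le]
  obtain ⟨h1, h2⟩ := coord_bounds_of_larger_disc hx hl
  have hp : 0 < (1 / 2 : ℝ) ^ n * (1 / 2) ^ k / 800 := discRadius_pos (n, k)
  have h3 : (x 1 - discCenter (n, l) 1) ^ 2 ≤ (x 0 - discCenter (n, l) 0) ^ 2 :=
    sq_le_sq.2 (by linarith)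
  have : 0 ≤ (x 0 - discCenter (n, l) 0) ^ 2 - (x 1 - discCenter (n, l) 1) ^ 2 := by linarith
  positivity

/-- From `Y² ≤ X²/9` the quotient is at least `(8/9)(81/100)/(4X²)`, and `X² ≤ 81ρ²` makes this
`1/(450ρ²)`; 512 leaves room. -/
theorem kernel_lower_bound {X Y ρ : ℝ} (hρ : 0 < ρ) (h1 : 3 * ρ ≤ X) (h2 : X ≤ 9 * ρ) (h3 : |Y| ≤ ρ) :
    1 / (512 * ρ ^ 2) ≤ (X ^ 2 - Y ^ 2) / (4 * (X ^ 2 + Y ^ 2) ^ 2) := by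
  have hX : 0 < X := by linarith
  have hY : Y ^ 2 ≤ X ^ 2 / 9 := by
    have : Y ^ 2 ≤ ρ ^ 2 := sq_le_sq' (abs_le.1 h3).1 (abs_le.1 h3).2
    nlinarith
  have hX2 : X ^ 2 ≤ 81 * ρ ^ 2 := by nlinarith
  have hpos : 0 < X ^ 2 + Y ^ 2 := by positivity
  have hsq : (X ^ 2 + Y ^ 2) ^ 2 ≤ (10 / 9 * X ^ 2) ^ 2 :=
    pow_le_pow_left₀ hpos.le (by linarith) 2
  rw [div_le_div_iff₀ (by positivity) (by positivity)]
  have hX4 : 0 < X ^ 2 := by positivity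
  nlinarith [mul_le_mul_of_nonneg_left hX2 hX4.le, mul_pos hX4 (pow_pos hρ 2)]

/-- The mass ratio of the two discs is `(999/1000)^(m+1)`, and the squared radius of disc `k`
cancels against the kernel bound. -/
theorem response_ge_of_smaller_disc (hx : ‖x - discCenter (n, k)‖ ≤ discRadius (n, k)) (m : ℕ) :
    discCoeff (n, k) / 512 * (999 / 1000) ^ (m + 1) ≤ discCoeff (n, m + (k + 1)) *
      bumpResponse ((discRadius (n, m + (k + 1)))⁻¹ • (x - discCenter (n, m + (k + 1)))) := by
  have hl : k < m + (k + 1) := by omega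
  set l := m + (k + 1) with hldef
  have hni : ¬ ‖x - discCenter (n, l)‖ ≤ discRadius (n, l) := fun h =>
    hl.ne' (Prod.mk.inj (disjointDiscs _ _ x h hx)).2
  rw [bumpResponse_rescale (discRadius_pos _) (not_le.1 hni).le, ← mul_assoc]
  obtain ⟨h1, h2, h3⟩ := coord_bounds_of_smaller_disc hx hl
  have hp : 0 < (1 / 2 : ℝ) ^ n * (1 / 2) ^ k / 800 := discRadius_pos (n, k)
  have h4 := kernel_lower_bound hp h1 h2 h3
  have hc : 0 ≤ discCoeff (n, l) * discRadius (n, l) ^ 2 :=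
    mul_nonneg (discCoeff_pos _).le (sq_nonneg _)
  have h5 := mul_le_mul_of_nonneg_left h4 hc
  refine le_trans (le_of_eq ?_) h5
  have e1 := discCoeff_mul_discRadius_sq (n, l)
  have e2 := discCoeff_mul_discRadius_sq (n, k)
  have e3 : discCoeff (n, l) * discRadius (n, l) ^ 2 =
      discCoeff (n, k) * discRadius (n, k) ^ 2 * (999 / 1000) ^ (m + 1) := by
    rw [e1, e2, hldef]
    ring
  rw [e3]
  change _ = discCoeff (n, k) * ((1 / 2 : ℝ) ^ n * (1 / 2) ^ k / 800) ^ 2 * _ * _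
  field_simp

/-- `A` is meant to be the larger of the two heights, which is the scale of the distance. The kernel
in its worst direction is `-1/(4(A/4)²) = -4/A²`, to be multiplied by the mass. -/
theorem response_ge_of_other_cluster (hx : ‖x - discCenter (n, k)‖ ≤ discRadius (n, k)) {m : ℕ}
    (l : ℕ) (hm : m ≠ n) {A : ℝ} (hA : A = (1 / 2) ^ m ∨ A = (1 / 2) ^ n) (hmA : (1 / 2) ^ m ≤ A) :
    -((1 / 2) ^ m / A ^ 2 / 160000 * (999 / 1000) ^ l) ≤
      discCoeff (m, l) * bumpResponse ((discRadius (m, l))⁻¹ • (x - discCenter (m, l))) := by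
  have hA0 : 0 < A := (half_pow_pos m).trans_le hmA
  have h1 : A / 4 ≤ ‖x - discCenter (m, l)‖ := by
    rcases hA with rfl | rfl
    · exact (norm_ge_of_other_cluster hx l hm).1
    · exact (norm_ge_of_other_cluster hx l hm).2
  have hr : discRadius (m, l) ≤ A / 4 := by
    have := mul_le_of_le_one_right (half_pow_pos m).le (half_pow_le_one l)
    rw [discRadius]
    simp only
    linarith [half_pow_pos m]
  have h2 := neg_le_bumpResponse_rescale (discRadius_pos (m, l)) (by positivity) hr h1
  have h3 := mul_le_mul_of_nonneg_left h2 (discCoeff_pos (m, l)).le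
  refine le_trans (le_of_eq ?_) h3
  have e := discCoeff_mul_discRadius_sq (m, l)
  calc _ = -(1 / 640000 * ((1 / 2) ^ m * (999 / 1000) ^ l)) * (4 / A ^ 2) := by ring
    _ = -(discCoeff (m, l) * discRadius (m, l) ^ 2) * (4 / A ^ 2) := by rw [e]
    _ = _ := by field_simp

theorem tsum_geometric_response : ∑' l : ℕ, (999 / 1000 : ℝ) ^ l = 1000 := by
  rw [tsum_geometric_of_lt_one (by norm_num) (by norm_num)]; norm_num

theorem cluster_response_ge_of_ne (hx : ‖x - discCenter (n, k)‖ ≤ discRadius (n, k)) {m : ℕ}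
    (hm : m ≠ n) {A : ℝ} (hA : A = (1 / 2) ^ m ∨ A = (1 / 2) ^ n) (hmA : (1 / 2) ^ m ≤ A) :
    -((1 / 2) ^ m / A ^ 2 / 160) ≤ ∑' l, discCoeff (m, l) *
      bumpResponse ((discRadius (m, l))⁻¹ • (x - discCenter (m, l))) := by
  have hs := (summable_response_on_disc hx).prod_factor m
  have hg : Summable fun l : ℕ => -((1 / 2) ^ m / A ^ 2 / 160000 * (999 / 1000 : ℝ) ^ l) :=
    ((summable_geometric_of_lt_one (by norm_num) (by norm_num)).mul_left _).neg
  have h := hg.tsum_le_tsum (fun l => response_ge_of_other_cluster hx l hm hA hmA) hs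
  refine le_trans (le_of_eq ?_) h
  rw [tsum_neg, tsum_mul_left, tsum_geometric_response]
  ring

/-- In units of `discCoeff (n, k)`, the smaller discs contribute at least `999/512`, the disc itself
at least `-1/2` and the larger discs at least `0`; the total exceeds `1`. -/
theorem cluster_response_ge (hx : ‖x - discCenter (n, k)‖ ≤ discRadius (n, k)) :
    discCoeff (n, k) ≤ ∑' l, discCoeff (n, l) *
      bumpResponse ((discRadius (n, l))⁻¹ • (x - discCenter (n, l))) := by
  have hs := (summable_response_on_disc hx).prod_factor n
  rw [← hs.sum_add_tsum_nat_add (k + 1), Finset.sum_range_succ]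
  have h1 : 0 ≤ ∑ l ∈ Finset.range k, discCoeff (n, l) *
      bumpResponse ((discRadius (n, l))⁻¹ • (x - discCenter (n, l))) :=
    Finset.sum_nonneg fun l hl => response_nonneg_of_larger_disc hx (Finset.mem_range.1 hl)
  have hc := discCoeff_pos (n, k)
  have h2 : -(discCoeff (n, k) / 2) ≤ discCoeff (n, k) *
      bumpResponse ((discRadius (n, k))⁻¹ • (x - discCenter (n, k))) := by
    have := neg_half_le_bumpResponse ((norm_rescale_le_one (discRadius_pos (n, k))).2 hx)
    nlinarith
  have hg : Summable fun m : ℕ => discCoeff (n, k) / 512 * (999 / 1000 : ℝ) ^ (m + 1) :=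
    ((summable_nat_add_iff 1).2
      (summable_geometric_of_lt_one (by norm_num) (by norm_num))).mul_left _
  have hs₂ := hs.comp_injective (add_left_injective (k + 1))
  have h3 := hg.tsum_le_tsum (response_ge_of_smaller_disc hx) hs₂
  simp_rw [pow_succ'] at h3
  rw [tsum_mul_left, tsum_mul_left, tsum_geometric_response] at h3
  linarith

/-- The own cluster gives at least `2ⁿ`. Clusters `m < n` cost at most `2^m/160` each and clusters
`m > n` at most `2^(2n-m)/160` each, so either family costs at most `2ⁿ/160`. -/
theorem responseSum_nonneg (hx : ‖x - discCenter (n, k)‖ ≤ discRadius (n, k)) :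
    0 ≤ responseSum discCoeff discRadius discCenter x := by
  have hs := summable_response_on_disc hx
  rw [responseSum, hs.tsum_prod]
  have hs' := hs.prod
  rw [← hs'.sum_add_tsum_nat_add (n + 1), Finset.sum_range_succ]
  have h2n : (2 : ℝ) ^ n * (1 / 2) ^ n = 1 := by rw [← mul_pow]; norm_num
  have a0 := half_pow_pos n
  have h1 : -((2 : ℝ) ^ n / 160) ≤ ∑ m ∈ Finset.range n, ∑' l, discCoeff (m, l) *
      bumpResponse ((discRadius (m, l))⁻¹ • (x - discCenter (m, l))) := by
    calc -((2 : ℝ) ^ n / 160) ≤ ∑ m ∈ Finset.range n, -((2 : ℝ) ^ m / 160) := by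
          rw [Finset.sum_neg_distrib, ← Finset.sum_div, geom_sum_eq (by norm_num)]
          linarith
      _ ≤ _ := by
        refine Finset.sum_le_sum fun m hm => ?_
        have hm' : m < n := Finset.mem_range.1 hm
        refine le_trans (le_of_eq ?_)
          (cluster_response_ge_of_ne hx hm'.ne (A := (1 / 2) ^ m) (.inl rfl) le_rfl)
        have h2m : (2 : ℝ) ^ m * (1 / 2) ^ m = 1 := by rw [← mul_pow]; norm_num
        have b0 := half_pow_pos m
        rw [← eq_div_iff b0.ne'] at h2m
        rw [h2m]
        field_simp
  have h2 := cluster_response_ge hx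
  have hg : Summable fun m : ℕ => -((2 : ℝ) ^ n / 320 * (1 / 2) ^ m) :=
    ((summable_geometric_of_lt_one (by norm_num) (by norm_num)).mul_left _).neg
  have hs₂ := hs'.comp_injective (add_left_injective (n + 1))
  have h3 := hg.tsum_le_tsum (g := fun m => ∑' l, discCoeff (m + (n + 1), l) *
      bumpResponse ((discRadius (m + (n + 1), l))⁻¹ • (x - discCenter (m + (n + 1), l))))
    (fun m => by
      have hm : n < m + (n + 1) := by omega
      refine le_trans (le_of_eq ?_) (cluster_response_ge_of_ne hx hm.ne' (A := (1 / 2) ^ n) (.inr rfl)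
        ((half_pow_le_of_lt hm).trans (by linarith)))
      rw [← eq_div_iff a0.ne'] at h2n
      rw [h2n, pow_add, pow_succ]
      field_simp
      norm_num)
    hs₂
  rw [tsum_neg, tsum_mul_left, tsum_geometric_of_lt_one (by norm_num) (by norm_num)] at h3
  have hc : (2 : ℝ) ^ n ≤ discCoeff (n, k) := by
    rw [discCoeff]
    exact le_mul_of_one_le_right (by positivity) (one_le_pow₀ (by norm_num))
  have h20 : (0 : ℝ) < 2 ^ n := by positivity
  norm_num at h3
  linarith

end OnDisc

/-! ### Location of the discs -/

/-- The polar angle has `|cos θ| ≤ 1/10`, while on the boundary of the cone `|cos θ| = sin(π/8) ≥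
1/4` by Jordan's inequality. -/
theorem mem_verticalCone_of_abs_le {x : Plane} (h1 : 0 < x 1) (h0 : |x 0| ≤ x 1 / 10) :
    x ∈ verticalCone := by
  have hn := norm_sq_eq x
  have hpos : 0 < ‖x‖ := by
    refine norm_pos_iff.2 fun h => ?_
    rw [h] at h1
    simp at h1
  have h1n : x 1 ≤ ‖x‖ := (le_abs_self _).trans (abs_coord_le_norm x 1)
  set t := x 0 / ‖x‖ with ht
  have htb : |t| ≤ 1 / 10 := by
    rw [ht, abs_div, abs_norm, div_le_iff₀ hpos]
    linarith
  have hs : 1 / 10 < Real.sin (Real.pi / 8) := by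
    have := Real.mul_le_sin (x := Real.pi / 8) (by positivity) (by linarith [Real.pi_pos])
    have e : 2 / Real.pi * (Real.pi / 8) = 1 / 4 := by
      have := Real.pi_ne_zero
      field_simp
      norm_num
    linarith
  have hc1 : Real.cos (3 * Real.pi / 8) = Real.sin (Real.pi / 8) := by
    rw [← Real.cos_pi_div_two_sub]; congr 1; ring
  have hc2 : Real.cos (5 * Real.pi / 8) = -Real.sin (Real.pi / 8) := by
    rw [← hc1, ← Real.cos_pi_sub]; congr 1; ring
  have htl := abs_le.1 htb
  have hpi := Real.pi_pos
  refine ⟨‖x‖, Real.arccos t, hpos, ?_, ?_, ?_, ?_⟩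
  · rw [abs_of_nonneg (Real.arccos_nonneg _)]
    by_contra h
    have := Real.cos_le_cos_of_nonneg_of_le_pi (Real.arccos_nonneg t) (by linarith) (not_lt.1 h)
    rw [Real.cos_arccos (by linarith [htl.1]) (by linarith [htl.2]), hc1] at this
    linarith [htl.2]
  · rw [abs_of_nonneg (Real.arccos_nonneg _)]
    by_contra h
    have := Real.cos_le_cos_of_nonneg_of_le_pi (by positivity) (Real.arccos_le_pi t) (not_lt.1 h)
    rw [Real.cos_arccos (by linarith [htl.1]) (by linarith [htl.2]), hc2] at this
    linarith [htl.1]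
  · rw [Real.cos_arccos (by linarith [htl.1]) (by linarith [htl.2]), ht]
    field_simp
  · rw [Real.sin_arccos, ht]
    have e : 1 - (x 0 / ‖x‖) ^ 2 = (x 1 / ‖x‖) ^ 2 := by
      rw [div_pow, div_pow, eq_div_iff (by positivity), sub_mul, one_mul,
        div_mul_cancel₀ _ (by positivity), hn]
      ring
    rw [e, Real.sqrt_sq (by positivity)]
    field_simp

theorem exists_mem_disc_of_bumpSum_ne_zero {x : Plane}
    (hx : bumpSum discCoeff discRadius discCenter x ≠ 0) :
    ∃ i, ‖x - discCenter i‖ ≤ discRadius i := by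
  by_contra! h
  exact hx (bumpSum_eq_zero discRadius_pos h)

theorem support_bumpSum_subset_verticalCone :
    Function.support (bumpSum discCoeff discRadius discCenter) ⊆ verticalCone := by
  intro x hx
  obtain ⟨i, hi⟩ := exists_mem_disc_of_bumpSum_ne_zero hx
  obtain ⟨h0, h1⟩ := abs_coord_sub_le_of_mem_disc hi
  rw [abs_le] at h0 h1
  have a0 := half_pow_pos i.1
  have a1 := mul_le_of_le_one_right a0.le (half_pow_le_one i.2)
  have a2 := mul_pos a0 (half_pow_pos i.2)
  refine mem_verticalCone_of_abs_le (by linarith [h1.1]) (abs_le.2 ⟨?_, ?_⟩)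
  · linarith [h0.1, h1.1]
  · linarith [h0.2, h1.1]

/-- The closed discs together with their accumulation points, parametrised by a compact set. -/
def discMap (w : ℝ × ℝ × Plane) : Plane :=
  w.1 • (EuclideanSpace.single 1 1 +
    (w.2.1 / 100) • (EuclideanSpace.single 0 1 + (1 / 8 : ℝ) • w.2.2))

/-- The sequence `2⁻ⁿ` together with its limit. -/
def halfPowers : Set ℝ := insert 0 (Set.range fun n : ℕ => (1 / 2 : ℝ) ^ n)

theorem isCompact_halfPowers : IsCompact halfPowers :=
  (tendsto_pow_atTop_nhds_zero_of_lt_one (by norm_num) (by norm_num)).isCompact_insert_range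

theorem isClosed_discUnion :
    IsClosed (discMap '' (halfPowers ×ˢ halfPowers ×ˢ Metric.closedBall (0 : Plane) 1)) := by
  refine ((isCompact_halfPowers.prod
    (isCompact_halfPowers.prod (isCompact_closedBall 0 1))).image ?_).isClosed
  unfold discMap
  fun_prop

theorem discCenter_eq (i : ℕ × ℕ) : discCenter i = (1 / 2 : ℝ) ^ i.1 •
    (EuclideanSpace.single 1 1 + ((1 / 2 : ℝ) ^ i.2 / 100) • EuclideanSpace.single 0 1) := by
  ext j
  fin_cases j <;> simp
  ring

theorem tsupport_bumpSum_subset :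
    tsupport (bumpSum discCoeff discRadius discCenter) ⊆
      discMap '' (halfPowers ×ˢ halfPowers ×ˢ Metric.closedBall (0 : Plane) 1) := by
  refine closure_minimal (fun x hx => ?_) isClosed_discUnion
  obtain ⟨i, hi⟩ := exists_mem_disc_of_bumpSum_ne_zero hx
  have hr := discRadius_pos i
  refine ⟨((1 / 2) ^ i.1, (1 / 2) ^ i.2, (discRadius i)⁻¹ • (x - discCenter i)),
    ⟨.inr ⟨_, rfl⟩, .inr ⟨_, rfl⟩, ?_⟩, ?_⟩
  · simpa only [mem_closedBall_zero_iff] using (norm_rescale_le_one hr).2 hi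
  · have e : (1 / 2 : ℝ) ^ i.1 * ((1 / 2) ^ i.2 / 100 * (1 / 8 * (discRadius i)⁻¹)) = 1 := by
      have a0 := half_pow_pos i.1
      have b0 := half_pow_pos i.2
      rw [discRadius]
      field_simp
      norm_num
    simp only [discMap, smul_add, smul_smul] at e ⊢
    rw [e, one_smul]
    conv_rhs => rw [← sub_add_cancel x (discCenter i), add_comm]
    nth_rewrite 2 [discCenter_eq i]
    simp only [smul_add, smul_smul]
    rw [add_assoc]

/-- In the compact parametrisation, the limit value `0` of the first parameter yields the origin and
that of the second a tip: countably many points, hence a null set. -/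
theorem ae_mem_disc_of_mem_tsupport : ∀ᵐ x ∂(volume : Measure Plane),
    x ∈ tsupport (bumpSum discCoeff discRadius discCenter) →
      ∃ i, ‖x - discCenter i‖ ≤ discRadius i := by
  have hcount : (insert (0 : Plane) (Set.range fun n : ℕ =>
      (1 / 2 : ℝ) ^ n • (EuclideanSpace.single 1 1 : Plane))).Countable :=
    (Set.countable_range _).insert _
  filter_upwards [compl_mem_ae_iff.2 (hcount.measure_zero volume)] with x hx hxs
  obtain ⟨⟨a, b, v⟩, ⟨ha, hb, hv⟩, rfl⟩ := tsupport_bumpSum_subset hxs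
  rcases ha with ha | ⟨n, hn⟩
  · exact absurd (.inl (by simp only [discMap] at ha ⊢; rw [ha, zero_smul])) hx
  rcases hb with hb | ⟨k, hk⟩
  · refine absurd (.inr ⟨n, ?_⟩) hx
    simp only at hb hn
    simp only [discMap, hb, hn, zero_div, zero_smul, add_zero]
  refine ⟨(n, k), ?_⟩
  simp only at hn hk
  have e : discMap (a, b, v) - discCenter (n, k) = discRadius (n, k) • v := by
    rw [discCenter_eq, discRadius, discMap]
    simp only [hn, hk]
    module
  rw [e, norm_smul, Real.norm_of_nonneg (discRadius_pos _).le]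
  exact mul_le_of_le_one_right (discRadius_pos _).le (by simpa using hv)

/-- A single cluster close enough to the origin suffices: its values of `c² r²` grow with ratio
`(999/250)²/4 = 998001/250000 > 1`. -/
theorem not_memLp_two_bumpSum_ball {δ : ℝ} (hδ : 0 < δ) :
    ¬ MemLp (bumpSum discCoeff discRadius discCenter) 2 (volume.restrict (Metric.ball 0 δ)) := by
  obtain ⟨n, hn⟩ := exists_pow_lt_of_lt_one (show 0 < δ / 2 by positivity)
    (show (1 / 2 : ℝ) < 1 by norm_num)
  refine not_memLp_two_bumpSum discRadius_pos disjointDiscs (fun k => (n, k)) (fun k x hx => ?_) ?_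
  · have hx' : ‖x - discCenter (n, k)‖ ≤ discRadius (n, k) := by
      simpa [Metric.mem_closedBall, dist_eq_norm] using hx
    obtain ⟨h0, h1⟩ := abs_coord_sub_le_of_mem_disc hx'
    rw [abs_le] at h0 h1
    simp only at h0 h1
    have a0 := half_pow_pos n
    have a1 := mul_le_of_le_one_right a0.le (half_pow_le_one k)
    have a2 := mul_pos a0 (half_pow_pos k)
    rw [mem_ball_zero_iff]
    have hn2 := norm_sq_eq x
    have hb0 : x 0 ^ 2 ≤ (1 / 2 * (1 / 2) ^ n) ^ 2 :=
      sq_le_sq' (by linarith [h0.1]) (by linarith [h0.2])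
    have hb1 : x 1 ^ 2 ≤ (3 / 2 * (1 / 2) ^ n) ^ 2 :=
      sq_le_sq' (by linarith [h1.1]) (by linarith [h1.2])
    have : ‖x‖ ≤ 2 * (1 / 2) ^ n := abs_le_of_sq_le_sq' (by nlinarith) (by positivity) |>.2
    linarith
  · have e : ∀ k : ℕ, discCoeff (n, k) ^ 2 * discRadius (n, k) ^ 2 =
        1 / 640000 * (998001 / 250000) ^ k := by
      intro k
      have h1 : ((2 : ℝ) ^ n) ^ 2 * ((1 / 2) ^ n) ^ 2 = 1 := by
        rw [← mul_pow, ← mul_pow]; norm_num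
      have h2 : ((999 / 250 : ℝ) ^ k) ^ 2 * ((1 / 2) ^ k) ^ 2 = (998001 / 250000) ^ k := by
        rw [← mul_pow, ← mul_pow, ← pow_mul, mul_comm k, pow_mul]; norm_num
      rw [discCoeff, discRadius, ← h2]
      linear_combination (1 / 640000 * ((999 / 250 : ℝ) ^ k) ^ 2 * ((1 / 2) ^ k) ^ 2) * h1
    simp_rw [e]
    exact (tendsto_pow_atTop_atTop_of_one_lt (by norm_num)).const_mul_atTop (by norm_num)

end RieszSquare

end

/-! ### Assembly of the theorem -/

open RieszSquare

theorem theorem3p2 :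
    -- `R₁²` is a (bounded) negative operator on `L²`
    (∃ A : Lp ℂ 2 (volume : Measure RieszSquare.Plane) →L[ℂ]
          Lp ℂ 2 (volume : Measure RieszSquare.Plane),
        (∀ f : Lp ℂ 2 (volume : Measure RieszSquare.Plane), RieszSquare.IsRieszOneSq f (A f)) ∧ (-A).IsPositive) ∧
    ∃ W g : RieszSquare.Plane → ℝ,
      Integrable W volume ∧
      (∀ x, 0 ≤ W x) ∧
      ¬ (W =ᵐ[volume] 0) ∧
      -- `g = R₁² W`, and it is non-negative on the (closed) support of `W`
      RieszSquare.IsRieszOneSq (fun x => (W x : ℂ)) (fun x => (g x : ℂ)) ∧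
      (∀ᵐ x ∂volume, x ∈ tsupport W → 0 ≤ g x) ∧
      -- `W` is not in `L²`, but lies in some `Lᵖ` with `1 < p < 2`
      ¬ MemLp W 2 volume ∧
      (∃ p : ℝ≥0∞, 1 < p ∧ p < 2 ∧ MemLp W p volume) ∧
      -- `W` lives in the cone around `θ = π/2`
      Function.support W ⊆ RieszSquare.verticalCone ∧
      -- `W` is singular at the origin: not square integrable in any neighbourhood of it
      (∀ δ : ℝ, 0 < δ → ¬ MemLp W 2 (volume.restrict (Metric.ball 0 δ))) := by
  have hc : ∀ i, 0 ≤ discCoeff i := fun i => (discCoeff_pos i).le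
  have hL2 : ¬ MemLp (bumpSum discCoeff discRadius discCenter) 2 volume := fun h =>
    not_memLp_two_bumpSum_ball one_pos (h.restrict _)
  refine ⟨⟨rieszOneSqL2, isRieszOneSq_rieszOneSqL2, isPositive_neg_rieszOneSqL2⟩,
    bumpSum discCoeff discRadius discCenter, responseSum discCoeff discRadius discCenter,
    integrable_bumpSum hc discRadius_pos summable_discCoeff_mul_sq, bumpSum_nonneg hc, fun h => ?_,
    isRieszOneSq_bumpSum holderConjugate_exponent hc discRadius_pos summable_discCoeff_mul_sq
      summable_discCoeff_mul_rpow, ?_, hL2,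
    ⟨ENNReal.ofReal (3000 / 2999), ?_, ?_, memLp_bumpSum (by norm_num) hc discRadius_pos
      summable_discCoeff_mul_sq disjointDiscs summable_discCoeff_rpow_mul_sq⟩,
    support_bumpSum_subset_verticalCone, fun δ hδ => not_memLp_two_bumpSum_ball hδ⟩
  · exact hL2 ((memLp_congr_ae h).2 MemLp.zero')
  · filter_upwards [ae_mem_disc_of_mem_tsupport] with x hx hxs
    obtain ⟨⟨n, k⟩, hi⟩ := hx hxs
    exact responseSum_nonneg hi
  · rw [← ENNReal.ofReal_one, ENNReal.ofReal_lt_ofReal_iff (by norm_num)]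
    norm_num
  · rw [← ENNReal.ofReal_ofNat 2, ENNReal.ofReal_lt_ofReal_iff (by norm_num)]
    norm_num
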